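/- Let $k$ be odd, let $M$ be a smooth manifold of dimension $k+1$, and let $TM\simeq S^k(E)$ be a $GL(2)$-structure on $M$, i.e. a smooth isomorphism of vector bundles, where $E\to M$ is a smooth real vector bundle of rank 2. Let $\pi\colon B(E)\to M$ be the principal $GL(2)$-bundle of bases $(x,y)$ of the fibres of $E$, with right action $(x,y)\mapsto(x,y)g$; each basis $(x,y)$ of $E_p$ determines the frame $(x^k,x^{k-1}y,\dots,y^k)$ of $T_pM$. Let $\omega=(\omega^0,\dots,\omega^k)^t$ be the soldering form on $B(E)$ (the coordinates of $\pi_*X$ in this frame), with values in the space $\mathbb V_k$ of homogeneous polynomials of degree $k$ in $(x,y)$. Let $$\phi=\begin{pmatrix}\phi^1_1&\phi^2_1\\ \phi^1_2&\phi^2_2\end{pmatrix}$$ be a smooth $\mathfrak{gl}(2)$-valued connection form on $B(E)$, and let $\Phi$ be the form with values in $\operatorname{End}(\mathbb V_k)$ induced by $x\mapsto\phi^1_1x+\phi^1_2y$, $y\mapsto\phi^2_1x+\phi^2_2y$ acting on $\mathbb V_k$ by derivations. The torsion and the curvature are the horizontal 2-forms $$\Theta=d\omega+\Phi\wedge\omega,\qquad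 \Omega=d\phi+\phi\wedge\phi .$$ For $0\le j\le\lfloor k/2\rfloor$ let $V_j^{even}$ and $V_j^{odd}$ be $(x^2+y^2)^j$ times the real and the imaginary part of $(x+\mathrm i y)^{k-2j}$. These polynomials form a basis of $\mathbb V_k$; let $(\xi^j_{even},\xi^j_{odd})$ be the dual basis and put $\xi^j=\xi^j_{even}+\mathrm i\,\xi^j_{odd}$. Composing with $\omega$, regard $\xi^j$ as complex-valued horizontal 1-forms on $B(E)$; together with the $\bar\xi^j$ they form a basis of the complex horizontal 1-forms. Put $\zeta(A)=(a^1_2+a^2_1)+\mathrm i(a^2_2-a^1_1)$ for $A=\begin{pmatrix}a^1_1&a^2_1\\a^1_2&a^2_2\end{pmatrix}\in\mathfrak{gl}(2)$, and write $$\xi^j(\Theta)=\sum_{a<b}T^{(2,0)j}_{ab}\,\xi^a\wedge\xi^b+\sum_{a,b}T^{(1,1)j}_{ab}\,\xi^a\wedge\bar\xi^b+\sum_{a<b}T^{(0,2)j}_{ab}\,\bar\xi^a\wedge\bar\xi^b,$$ $$\zeta(\Omega)=\sum_{a<b}C^{(2,0)}_{ab}\,\xi^a\wedge\xi^b+\sum_{a,b}C^{(1,1)}_{ab}\,\xi^a\wedge\bar\xi^b+\sum_{a<b}C^{(0,2)}_{ab}\,\bar\xi^a\wedge\bar\xi^b,$$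 where the coefficients are functions on $B(E)$. If $T^{(1,1)}=0$ and $T^{(0,2)}=0$ identically on $B(E)$, then $C^{(0,2)}=0$ identically on $B(E)$. -/

import Mathlib

open Bundle TensorProduct
open scoped Manifold ContDiff

noncomputable section

namespace GL2

/-! ### Homogeneous polynomials of degree `k` in `x, y` and their complex structure (`k` odd) -/

/-- The space `𝕍_k` of homogeneous polynomials of degree `k` in two variables, in coordinates with
respect to the standard basis `x^k, x^(k-1) y, …, y^k`. -/
abbrev V (k : ℕ) : Type := Fin (k + 1) → ℝ

/-- The coordinates of a homogeneous polynomial of degree `k` in the basis `x^(k-i) y^i`. -/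
def coords (k : ℕ) (P : MvPolynomial (Fin 2) ℝ) : V k :=
  fun i => P.coeff (Finsupp.single 0 (k - (i : ℕ)) + Finsupp.single 1 (i : ℕ))

/-- `W_i^even`, the real part of `(x + i y)^i`. -/
def WEven (i : ℕ) : MvPolynomial (Fin 2) ℝ :=
  ∑ s ∈ Finset.range (i / 2 + 1), MvPolynomial.C ((-1) ^ s * (i.choose (2 * s) : ℝ)) *
    MvPolynomial.X 0 ^ (i - 2 * s) * MvPolynomial.X 1 ^ (2 * s)

/-- `W_i^odd`, the imaginary part of `(x + i y)^i`. -/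
def WOdd (i : ℕ) : MvPolynomial (Fin 2) ℝ :=
  ∑ s ∈ Finset.range ((i - 1) / 2 + 1), MvPolynomial.C ((-1) ^ s * (i.choose (2 * s + 1) : ℝ)) *
    MvPolynomial.X 0 ^ (i - 2 * s - 1) * MvPolynomial.X 1 ^ (2 * s + 1)

/-- `V_{k,j}^even = (x² + y²)^j W_{k-2j}^even`. -/
def VEven (k j : ℕ) : V k :=
  coords k ((MvPolynomial.X 0 ^ 2 + MvPolynomial.X 1 ^ 2) ^ j * WEven (k - 2 * j))

/-- `V_{k,j}^odd = (x² + y²)^j W_{k-2j}^odd`. -/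
def VOdd (k j : ℕ) : V k :=
  coords k ((MvPolynomial.X 0 ^ 2 + MvPolynomial.X 1 ^ 2) ^ j * WOdd (k - 2 * j))

/-- The real-linear map `z ↦ ∑_j (Re z_j V_{k,j}^even + Im z_j V_{k,j}^odd)`, `0 ≤ j ≤ ⌊k/2⌋`;
it is an isomorphism onto `𝕍_k` when `k` is odd. -/
def fromXi (k : ℕ) : (Fin (k / 2 + 1) → ℂ) →L[ℝ] V k :=
  ∑ j : Fin (k / 2 + 1),
    ((Complex.reCLM.comp (ContinuousLinearMap.proj j)).smulRight (VEven k j) +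
      (Complex.imCLM.comp (ContinuousLinearMap.proj j)).smulRight (VOdd k j))

/-- The `(1,0)`-forms `ξ^{k,j} = ξ^{k,j}_even + i ξ^{k,j}_odd`, `0 ≤ j ≤ ⌊k/2⌋`, where
`(ξ^{k,j}_even, ξ^{k,j}_odd)` is the basis dual to `(V_{k,j}^even, V_{k,j}^odd)` (`k` odd). -/
def xi (k : ℕ) : V k →L[ℝ] (Fin (k / 2 + 1) → ℂ) := (fromXi k).inverse

/-- The coefficient of `ξ^a ∧ ξ̄^b` in a complex-valued real-bilinear alternating form `β` on `𝕍_k`.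
It is the value of the complex-bilinear extension of `β` at `(∂_a, ∂̄_b)`, where
`∂_a = (V_a^even - i V_a^odd) / 2`, `∂̄_a = (V_a^even + i V_a^odd) / 2` is the complex basis dual
to `(ξ^a, ξ̄^a)`. -/
def comp11 (k : ℕ) (β : V k → V k → ℂ) (a b : Fin (k / 2 + 1)) : ℂ :=
  (β (VEven k a) (VEven k b) + Complex.I * β (VEven k a) (VOdd k b)
    - Complex.I * β (VOdd k a) (VEven k b) + β (VOdd k a) (VOdd k b)) / 4

/-- The coefficient of `ξ̄^a ∧ ξ̄^b` (`a < b`) in a complex-valued real-bilinear alternating form `β`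
on `𝕍_k`: the value of the complex-bilinear extension of `β` at `(∂̄_a, ∂̄_b)`. -/
def comp02 (k : ℕ) (β : V k → V k → ℂ) (a b : Fin (k / 2 + 1)) : ℂ :=
  (β (VEven k a) (VEven k b) + Complex.I * β (VEven k a) (VOdd k b)
    + Complex.I * β (VOdd k a) (VEven k b) - β (VOdd k a) (VOdd k b)) / 4

/-- The irreducible representation of `𝔤𝔩(2)` on `𝕍_k` in the basis `x^(k-i) y^i`. For
`A = !![φ¹₁, φ²₁; φ¹₂, φ²₂]` it is induced by `x ↦ φ¹₁ x + φ¹₂ y`, `y ↦ φ²₁ x + φ²₂ y`. -/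
def rep (k : ℕ) (A : Matrix (Fin 2) (Fin 2) ℝ) : Matrix (Fin (k + 1)) (Fin (k + 1)) ℝ :=
  Matrix.of fun r c =>
    if (r : ℕ) = c then ((k : ℝ) - (c : ℕ)) * A 0 0 + (c : ℕ) * A 1 1
    else if (r : ℕ) = (c : ℕ) + 1 then ((k : ℝ) - (c : ℕ)) * A 1 0
    else if (r : ℕ) + 1 = c then (c : ℕ) * A 0 1
    else 0

/-! ### One-forms and their exterior derivative on a manifold without boundary -/

section Forms

variable {EN : Type*} [NormedAddCommGroup EN] [NormedSpace ℝ EN] {HN : Type*} [TopologicalSpace HN]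
  (J : ModelWithCorners ℝ EN HN) {N : Type*} [TopologicalSpace N] [ChartedSpace HN N]

/-- Real-valued one-forms (a family of covectors; smoothness is a separate condition). -/
abbrev OneForm (N : Type*) [TopologicalSpace N] [ChartedSpace HN N] : Type _ :=
  (u : N) → TangentSpace J u →L[ℝ] ℝ

/-- The expression of a one-form in the preferred chart at `u`. -/
def OneForm.inChart {J : ModelWithCorners ℝ EN HN} (η : OneForm J N) (u : N) (z : EN) :
    EN →L[ℝ] ℝ :=
  (η ((extChartAt J u).symm z)).comp (mfderiv 𝓘(ℝ, EN) J (extChartAt J u).symm z)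

/-- A one-form is smooth on an open set `S` if around every point of `S` its coefficients are smooth
in the preferred chart. -/
def OneForm.SmoothOn {J : ModelWithCorners ℝ EN HN} (η : OneForm J N) (S : Set N) : Prop :=
  ∀ u ∈ S, ContDiffAt ℝ ∞ (η.inChart u) (extChartAt J u u)

/-- The exterior derivative `dη(X, Y)` of a one-form at `u`, computed in the preferred chart at `u`,
with the convention `dη(X, Y) = X(η(Y)) - Y(η(X)) - η([X, Y])`. -/
def OneForm.d {J : ModelWithCorners ℝ EN HN} (η : OneForm J N) (u : N) (X Y : TangentSpace J u) :
    ℝ :=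
  let D : EN →L[ℝ] EN →L[ℝ] ℝ := fderiv ℝ (η.inChart u) (extChartAt J u u)
  let X' : EN := mfderiv J 𝓘(ℝ, EN) (extChartAt J u) u X
  let Y' : EN := mfderiv J 𝓘(ℝ, EN) (extChartAt J u) u Y
  D X' Y' - D Y' X'

end Forms

/-! ### The bundle of bases of a rank two vector bundle -/

/-- The total space of `E ⊕ E`, for a vector bundle `E` of rank two. -/
abbrev Pairs {M : Type*} (E : M → Type*) : Type _ :=
  TotalSpace ((Fin 2 → ℝ) × (Fin 2 → ℝ)) (E ×ᵇ E)

/-- The model with corners of the total space of `E ⊕ E` over a manifold of dimension `k + 1`. -/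
abbrev pairsModel (k : ℕ) :=
  (𝓡 (k + 1)).prod 𝓘(ℝ, (Fin 2 → ℝ) × (Fin 2 → ℝ))

section Frames

variable {M : Type*} {E : M → Type*} [∀ p, AddCommGroup (E p)] [∀ p, Module ℝ (E p)]

variable (E) in
/-- `B(E)`: the open set of all bases `(x, y)` of fibres of `E` in the total space of `E ⊕ E`. -/
def frames : Set (Pairs E) :=
  {u | LinearIndependent ℝ ![u.snd.1, u.snd.2]}

/-- The right action of matrices: `(x, y) ↦ (x, y) g`. -/
def act (u : Pairs E) (g : Matrix (Fin 2) (Fin 2) ℝ) : Pairs E :=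
  ⟨u.proj, (g 0 0 • u.snd.1 + g 1 0 • u.snd.2, g 0 1 • u.snd.1 + g 1 1 • u.snd.2)⟩

end Frames

section Geometry

variable (k : ℕ)
  {M : Type*} [TopologicalSpace M] [ChartedSpace (EuclideanSpace ℝ (Fin (k + 1))) M]
  [IsManifold (𝓡 (k + 1)) ∞ M]
  (E : M → Type*) [∀ p, AddCommGroup (E p)] [∀ p, Module ℝ (E p)]
  [TopologicalSpace (TotalSpace (Fin 2 → ℝ) E)] [∀ p, TopologicalSpace (E p)]
  [FiberBundle (Fin 2 → ℝ) E]

/-- A `GL(2)`-structure: a smooth isomorphism of vector bundles `S^k(E) ≃ TM`. Smoothness says that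
products of smooth local sections of `E` are mapped to smooth local vector fields. -/
structure GL2Structure where
  /-- the isomorphism on fibres -/
  iso : (p : M) → (Sym[ℝ]^k (E p)) ≃ₗ[ℝ] TangentSpace (𝓡 (k + 1)) p
  smooth : ∀ (U : Set M) (s : Fin k → (p : M) → E p), IsOpen U →
    (∀ m, ContMDiffOn (𝓡 (k + 1)) ((𝓡 (k + 1)).prod 𝓘(ℝ, Fin 2 → ℝ)) ∞
      (fun p => (⟨p, s m p⟩ : TotalSpace (Fin 2 → ℝ) E)) U) →
    ContMDiffOn (𝓡 (k + 1)) (𝓡 (k + 1)).tangent ∞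
      (fun p => (⟨p, iso p (SymmetricPower.tprod ℝ fun m => s m p)⟩ :
        TangentBundle (𝓡 (k + 1)) M)) U

/-- A `GL(2)`-connection, as a smooth `𝔤𝔩(2)`-valued connection form on `B(E)`. The entry `(i, j)` of
the matrix `!![φ¹₁, φ²₁; φ¹₂, φ²₂]` is `form i j`. Only the values of `form` over `B(E)` matter. -/
structure GL2Connection where
  /-- the entries of the connection form -/
  form : Fin 2 → Fin 2 → OneForm (pairsModel k) (Pairs E)
  smooth : ∀ i j, (form i j).SmoothOn (frames E)
  /-- reproduces the generators of the action (the base point below is `u` itself) -/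
  fundamental : ∀ u ∈ frames E, ∀ (A : Matrix (Fin 2) (Fin 2) ℝ) (i j : Fin 2),
    form i j (act u (1 + (0 : ℝ) • A))
      (mfderiv 𝓘(ℝ, ℝ) (pairsModel k) (fun t : ℝ => act u (1 + t • A)) 0 (1 : ℝ)) = A i j
  /-- `(R_g)^* φ = g⁻¹ φ g` -/
  equivariant : ∀ u ∈ frames E, ∀ (g : Matrix (Fin 2) (Fin 2) ℝ), IsUnit g.det →
    ∀ (X : TangentSpace (pairsModel k) u) (i j : Fin 2),
      form i j (act u g)
          (mfderiv (pairsModel k) (pairsModel k) (fun w : Pairs E => act w g) u X) =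
        (g⁻¹ * (Matrix.of fun a b => form a b u X) * g) i j

variable {k E}

/-- The frame `(x^k, x^(k-1) y, …, y^k)` of `T_p M` defined by a basis `u = (x, y)` of `E_p`, as a
linear map `𝕍_k → T_p M`. -/
def GL2Structure.frameMap (σ : GL2Structure k E) (u : Pairs E) :
    V k →L[ℝ] TangentSpace (𝓡 (k + 1)) u.proj :=
  ∑ i : Fin (k + 1), (ContinuousLinearMap.proj (R := ℝ) (φ := fun _ : Fin (k + 1) => ℝ) i).smulRight
    (σ.iso u.proj (SymmetricPower.tprod ℝ
      fun m : Fin k => if (m : ℕ) < k - (i : ℕ) then u.snd.1 else u.snd.2))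

/-- The canonical soldering form `ω = (ω⁰, …, ω^k)` on `B(E)`: the coordinates of the projection of a
tangent vector of `B(E)` to `M` in the frame `(x^k, x^(k-1) y, …, y^k)`. -/
def GL2Structure.solder (σ : GL2Structure k E) (i : Fin (k + 1)) :
    OneForm (pairsModel k) (Pairs E) :=
  fun u => (ContinuousLinearMap.proj (R := ℝ) (φ := fun _ : Fin (k + 1) => ℝ) i).comp
    ((σ.frameMap u).inverse.comp
      (mfderiv (pairsModel k) (𝓡 (k + 1)) (fun w : Pairs E => w.proj) u))

/-- The `𝔤𝔩(2)`-matrix `φ(X)`. -/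
def GL2Connection.mat (φ : GL2Connection k E) (u : Pairs E) (X : TangentSpace (pairsModel k) u) :
    Matrix (Fin 2) (Fin 2) ℝ :=
  Matrix.of fun i j => φ.form i j u X

/-- The torsion `Θ = dω + Φ ∧ ω`, where `Φ` is the matrix of `φ` acting on `𝕍_k`. -/
def torsion (σ : GL2Structure k E) (φ : GL2Connection k E) (u : Pairs E)
    (X Y : TangentSpace (pairsModel k) u) : V k :=
  fun i => (σ.solder i).d u X Y +
    ∑ j, (rep k (φ.mat u X) i j * σ.solder j u Y - rep k (φ.mat u Y) i j * σ.solder j u X)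

/-- The curvature `Ω = dφ + φ ∧ φ`. -/
def curvature (φ : GL2Connection k E) (u : Pairs E) (X Y : TangentSpace (pairsModel k) u) :
    Matrix (Fin 2) (Fin 2) ℝ :=
  (Matrix.of fun i j => (φ.form i j).d u X Y) +
    (φ.mat u X * φ.mat u Y - φ.mat u Y * φ.mat u X)

/-- The value on a matrix `!![φ¹₁, φ²₁; φ¹₂, φ²₂]` of `ζ = (φ¹₂ + φ²₁) + i (φ²₂ - φ¹₁)`. -/
def zeta (A : Matrix (Fin 2) (Fin 2) ℝ) : ℂ :=
  ((A 1 0 + A 0 1 : ℝ) : ℂ) + Complex.I * ((A 1 1 - A 0 0 : ℝ) : ℂ)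

/-- The horizontal lift of `v`: the tangent vector `X` of `B(E)` at `u` with `ω(X) = v` and
`φ(X) = 0`. -/
def horizontalLift (σ : GL2Structure k E) (φ : GL2Connection k E) (u : Pairs E) (v : V k) :
    TangentSpace (pairsModel k) u :=
  Function.invFun
    (fun X : TangentSpace (pairsModel k) u => ((fun i => σ.solder i u X : V k), φ.mat u X)) (v, 0)

/-- The coefficient `T^{(1,1)}` of `ξ^a ∧ ξ̄^b` in the component `ξ^j(Θ)` of the torsion at `u`. -/
def torsion11 (σ : GL2Structure k E) (φ : GL2Connection k E) (u : Pairs E)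
    (j a b : Fin (k / 2 + 1)) : ℂ :=
  comp11 k (fun v w =>
    xi k (torsion σ φ u (horizontalLift σ φ u v) (horizontalLift σ φ u w)) j) a b

/-- The coefficient `T^{(0,2)}` of `ξ̄^a ∧ ξ̄^b` in the component `ξ^j(Θ)` of the torsion at `u`. -/
def torsion02 (σ : GL2Structure k E) (φ : GL2Connection k E) (u : Pairs E)
    (j a b : Fin (k / 2 + 1)) : ℂ :=
  comp02 k (fun v w =>
    xi k (torsion σ φ u (horizontalLift σ φ u v) (horizontalLift σ φ u w)) j) a b

/-- The coefficient `C^{(0,2)}` of `ξ̄^a ∧ ξ̄^b` in the component `ζ(Ω)` of the curvature at `u`. -/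
def curvature02 (σ : GL2Structure k E) (φ : GL2Connection k E) (u : Pairs E)
    (a b : Fin (k / 2 + 1)) : ℂ :=
  comp02 k (fun v w =>
    zeta (curvature φ u (horizontalLift σ φ u v) (horizontalLift σ φ u w))) a b

end Geometry

end GL2

end

/-! The proof evaluates the first Bianchi identity on vectors of suitable type. Write `k = 2m+1`,
and let `J` (`mulI`) be the complex structure on `𝕍_k` for which every `ξ^j` is complex linear.
Vanishing of `T^{(1,1)}` and `T^{(0,2)}` says that the torsion is `J`-linear in each argument.
Because this holds at every frame, and `J` is a constant endomorphism of `𝕍_k`, it survives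
differentiation. The Bianchi identity therefore equates the cyclic sum of `Ω(x,y)·w` with a cyclic
sum of terms `T(x; y,w)` that are skew and `J`-linear in the last two arguments
(`exists_bianchi_tensor`). If two of the three vectors are of type `(0,1)`, each such term has one
of them in a `J`-linear slot, so its `ξ`-components vanish.

On the curvature side, complexify `𝕍_k` and use the basis `z^(k-c) z̄^c` with `z = x + i y`. Up to a
factor 2, `ξ^j` reads off the coefficient at `c = k-j` and `ξ̄^j` the one at `c = j`; an element of
`𝔤𝔩(2)` moves `c` by at most one. Hence `ξ^m` of `A·v` can involve `ξ̄^m(v)`, but `ξ^{m-1}` of `A·v`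
involves only `ξ^j(v)`, and the coefficient of `ξ^m(v)` is `m (i/2) ζ(A)` (`xi_rep`). Taking the
`ξ^{m-1}`-component on `(x, ȳ, w̄)`, with `ξ^m` the only nonzero coordinate of `x`, leaves a nonzero
multiple of `ζ(Ω(ȳ,w̄))`, which must vanish (`comp02_zeta_eq_zero`). For `k = 1` there is a single
index, and no nonzero `(0,2)`-form exists.

The rest transfers this algebra to `B(E)`. All forms are written in one chart of `E ⊕ E`; the
soldering form is shown smooth, the torsion horizontal (`flatTorsion_vertical`), and the intrinsic
exterior derivative is identified with the one in the chart (`OneForm.d_eq`). -/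

noncomputable section

open Filter Topology

namespace GL2

/-! ### The first Bianchi identity on a normed space. -/

section Bianchi

variable {F V G : Type*} [NormedAddCommGroup F] [NormedSpace ℝ F] [NormedAddCommGroup V]
  [NormedSpace ℝ V] [NormedAddCommGroup G] [NormedSpace ℝ G]

/-- The torsion `dθ + ρ(φ) ∧ θ` of a coframe `θ` and a connection form `φ` on a normed space. -/
def flatTorsion (ρ : G →L[ℝ] V →L[ℝ] V) (θ : F → F →L[ℝ] V) (φ : F → F →L[ℝ] G) (z X Y : F) : V :=
  fderiv ℝ θ z X Y - fderiv ℝ θ z Y X + (ρ (φ z X) (θ z Y) - ρ (φ z Y) (θ z X))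

theorem flatTorsion_swap (ρ : G →L[ℝ] V →L[ℝ] V) (θ : F → F →L[ℝ] V) (φ : F → F →L[ℝ] G)
    (z X Y : F) : flatTorsion ρ θ φ z X Y = - flatTorsion ρ θ φ z Y X := by
  simp only [flatTorsion]; abel

/-- A right inverse of a family of linear maps that is prescribed at one point. -/
theorem exists_rightInverse_family [CompleteSpace V] {θ : F → F →L[ℝ] V} {z₀ : F}
    (hθ : DifferentiableAt ℝ θ z₀) {ι : V →L[ℝ] F} (hι : (θ z₀).comp ι = .id ℝ V) :
    ∃ L : F → V →L[ℝ] F, L z₀ = ι ∧ (∀ᶠ z in 𝓝 z₀, (θ z).comp (L z) = .id ℝ V) ∧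
      ∃ L' : F →L[ℝ] V →L[ℝ] F, HasFDerivAt L L' z₀ ∧
        ∀ X v, L' X v = -ι (fderiv ℝ θ z₀ X (ι v)) := by
  have h1 : HasFDerivAt (fun z => (θ z).comp ι)
      ((ContinuousLinearMap.compL ℝ V F V).flip ι ∘L fderiv ℝ θ z₀) z₀ :=
    ((ContinuousLinearMap.compL ℝ V F V).flip ι).hasFDerivAt.comp z₀ hθ.hasFDerivAt
  have h0 : (θ z₀).comp ι = ((1 : (V →L[ℝ] V)ˣ) : V →L[ℝ] V) := hι
  have h2 : HasFDerivAt Ring.inverse (-ContinuousLinearMap.mulLeftRight ℝ (V →L[ℝ] V)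
      ↑(1 : (V →L[ℝ] V)ˣ)⁻¹ ↑(1 : (V →L[ℝ] V)ˣ)⁻¹) ((θ z₀).comp ι) := by
    rw [h0]; exact hasFDerivAt_ringInverse 1
  have h3 := h2.comp z₀ h1
  have h4 := (ContinuousLinearMap.compL ℝ V V F ι).hasFDerivAt.comp z₀ h3
  -- Near `z₀` the endomorphism `θ z ∘ ι` is close to the identity, hence a unit; composing `ι` with
  -- its inverse corrects `ι` to a right inverse. The derivative of inversion at the identity is
  -- minus the identity, which gives the formula for `L'`.
  refine ⟨fun z => ι.comp (Ring.inverse ((θ z).comp ι)), ?_, ?_, _, h4, ?_⟩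
  · simp only [hι]
    change ι.comp (Ring.inverse (1 : V →L[ℝ] V)) = ι
    rw [Ring.inverse_one]; rfl
  · have : ∀ᶠ z in 𝓝 z₀, IsUnit ((θ z).comp ι) := by
      have hu : {x : V →L[ℝ] V | IsUnit x} ∈ 𝓝 ((θ z₀).comp ι) := by
        rw [h0]; exact Units.nhds 1
      exact h1.continuousAt.eventually hu
    filter_upwards [this] with z hz
    rw [← ContinuousLinearMap.comp_assoc]
    exact Ring.mul_inverse_cancel _ hz
  · intro X v
    simp only [ContinuousLinearMap.comp_apply, neg_apply, map_neg, inv_one, Units.val_one,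
      ContinuousLinearMap.mulLeftRight_apply, one_mul, mul_one, ContinuousLinearMap.compL_apply,
      ContinuousLinearMap.flip_apply]

/-- At `z₀` the image of `ι` is horizontal, so `dφ` on it is the curvature, and the identity is `dΘ
+ Φ ∧ Θ = Ω ∧ ω` with the torsion terms collected in `T`. Only `J`-linearity and skewness of `T x`
are recorded: the derivative in the direction `x` has no reason to be `J`-linear in `x`. -/
theorem exists_bianchi_tensor [CompleteSpace V] (ρ : G →L[ℝ] V →L[ℝ] V) {θ : F → F →L[ℝ] V}
    {φ : F → F →L[ℝ] G} {z₀ : F} (hθ : ContDiffAt ℝ 2 θ z₀) (hφ : DifferentiableAt ℝ φ z₀)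
    (J : V →L[ℝ] V) {ι : V →L[ℝ] F} (hι : (θ z₀).comp ι = .id ℝ V) (hφι : (φ z₀).comp ι = 0)
    (hJ : ∀ᶠ z in 𝓝 z₀, ∀ X Y Y', θ z Y' = J (θ z Y) →
      flatTorsion ρ θ φ z X Y' = J (flatTorsion ρ θ φ z X Y)) :
    ∃ T : V → V → V → V, (∀ x y w, T x y (J w) = J (T x y w)) ∧ (∀ x y w, T x w y = - T x y w) ∧
      ∀ x y w,
        ρ (fderiv ℝ φ z₀ (ι x) (ι y) - fderiv ℝ φ z₀ (ι y) (ι x)) w +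
        ρ (fderiv ℝ φ z₀ (ι y) (ι w) - fderiv ℝ φ z₀ (ι w) (ι y)) x +
        ρ (fderiv ℝ φ z₀ (ι w) (ι x) - fderiv ℝ φ z₀ (ι x) (ι w)) y =
        T x y w + T y w x + T w x y := by
  have hθ1 : DifferentiableAt ℝ θ z₀ := hθ.differentiableAt (by norm_num)
  have hθ2 : DifferentiableAt ℝ (fderiv ℝ θ) z₀ :=
    (hθ.fderiv_right (m := 1) (by norm_num)).differentiableAt (by norm_num)
  obtain ⟨L, hL0, hLθ, L', hL, hL'⟩ := exists_rightInverse_family hθ1 hι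
  have hι' : ∀ v, θ z₀ (ι v) = v := fun v => DFunLike.congr_fun hι v
  have hφι' : ∀ v, φ z₀ (ι v) = 0 := fun v => DFunLike.congr_fun hφι v
  -- Away from `z₀` the vectors `L z v` need not be horizontal. This is harmless because `hJ` is
  -- assumed for all vectors, which horizontality of the torsion will justify.
  set τ : F → V → V → V := fun z v w => flatTorsion ρ θ φ z (L z v) (L z w) with hτ
  have hτJ : ∀ᶠ z in 𝓝 z₀, ∀ v w, τ z v (J w) = J (τ z v w) := by
    filter_upwards [hJ, hLθ] with z hz hz' v w
    refine hz _ _ _ ?_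
    have h := DFunLike.congr_fun hz'
    simp only [ContinuousLinearMap.comp_apply, ContinuousLinearMap.id_apply] at h
    rw [h, h]
  have hτs : ∀ z v w, τ z w v = - τ z v w := fun z v w => flatTorsion_swap ..
  set D2 := fderiv ℝ (fderiv ℝ θ) z₀
  have hD2 : ∀ X Y, D2 X Y = D2 Y X := fun X Y =>
    (hθ.isSymmSndFDerivAt (by simp)) X Y
  have key : ∀ v w, ∃ D : F →L[ℝ] V, HasFDerivAt (fun z => τ z v w) D z₀ ∧ ∀ X, D X =
      D2 X (ι v) (ι w) - D2 X (ι w) (ι v)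
      - (τ z₀ (fderiv ℝ θ z₀ X (ι v)) w + τ z₀ v (fderiv ℝ θ z₀ X (ι w)))
      + ρ (fderiv ℝ φ z₀ X (ι v)) w - ρ (fderiv ℝ φ z₀ X (ι w)) v := by
    intro v w
    have hLv : ∀ v, HasFDerivAt (fun z => L z v) (L'.flip v) z₀ := fun v => by
      simpa using hL.clm_apply (hasFDerivAt_const v z₀)
    have hA : ∀ v w, HasFDerivAt (fun z => fderiv ℝ θ z (L z v) (L z w)) _ z₀ := fun v w =>
      (hθ2.hasFDerivAt.clm_apply (hLv v)).clm_apply (hLv w)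
    have hB : ∀ v w, HasFDerivAt (fun z => ρ (φ z (L z v)) w) _ z₀ := fun v w =>
      ((ρ.hasFDerivAt.comp z₀ (hφ.hasFDerivAt.clm_apply (hLv v))).clm_apply
        (hasFDerivAt_const w z₀))
    have hC := ((hA v w).sub (hA w v)).add ((hB v w).sub (hB w v))
    refine ⟨_, hC.congr_of_eventuallyEq ?_, ?_⟩
    · filter_upwards [hLθ] with z hz
      have h := DFunLike.congr_fun hz
      simp only [ContinuousLinearMap.comp_apply, ContinuousLinearMap.id_apply] at h
      simp [hτ, flatTorsion, h]
    -- Differentiating `L` produces `-ι (Dθ_X (ι v))`, whose contributions reassemble into values of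
    -- `τ z₀`; the terms with an undifferentiated `φ` vanish because `φ z₀ ∘ ι = 0`.
    · intro X
      simp [hτ, flatTorsion, hL0, hL', hφι', hι', D2]
      abel
  choose D hD hDX using key
  have hDJ : ∀ v w X, D v (J w) X = J (D v w X) := by
    intro v w X
    have h1 := hD v (J w)
    have h2 : HasFDerivAt (fun z => τ z v (J w)) (J ∘L D v w) z₀ :=
      (J.hasFDerivAt.comp z₀ (hD v w)).congr_of_eventuallyEq (by
        filter_upwards [hτJ] with z hz using hz v w)
    rw [h1.unique h2]; rfl
  have hDs : ∀ v w X, D w v X = - D v w X := by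
    intro v w X
    have h2 : HasFDerivAt (fun z => τ z w v) (- D v w) z₀ := by
      have := (hD v w).neg
      refine this.congr_of_eventuallyEq (Eventually.of_forall fun z => hτs z v w)
    rw [(hD w v).unique h2]; rfl
  have hτ0 := hτJ.self_of_nhds
  have hτd : ∀ x y, τ z₀ x y = fderiv ℝ θ z₀ (ι x) (ι y) - fderiv ℝ θ z₀ (ι y) (ι x) := by
    intro x y; simp [hτ, flatTorsion, hL0, hφι']
  have hadd : ∀ x y y', τ z₀ x (y - y') = τ z₀ x y - τ z₀ x y' := by
    intro x y y'; simp only [hτ, flatTorsion, map_sub, sub_apply]; abel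
  -- The derivative of the torsion, minus the quadratic torsion term created by the varying right
  -- inverse `L`.
  refine ⟨fun x y w => D y w (ι x) - τ z₀ x (τ z₀ y w), ?_, ?_, ?_⟩
  · intro x y w; simp only [hDJ, hτ0, map_sub]
  · intro x y w
    have : τ z₀ x (- τ z₀ y w) = - τ z₀ x (τ z₀ y w) := by
      simp only [hτ, flatTorsion, map_neg, neg_apply]; abel
    simp only [hDs y w, hτs z₀ y w, this]; abel
  · intro x y w
    simp only [hDX, map_sub, sub_apply]
    rw [hτs z₀ w (fderiv ℝ θ z₀ (ι x) (ι y)), hτs z₀ x (fderiv ℝ θ z₀ (ι y) (ι w)),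
      hτs z₀ y (fderiv ℝ θ z₀ (ι w) (ι x))]
    rw [hτd y w, hτd w x, hτd x y]
    simp only [hadd]
    -- Symmetry of the second derivative makes the `D2` terms cancel in the cyclic sum: this is `d²
    -- = 0`.
    rw [hD2 (ι y) (ι x), hD2 (ι w) (ι x), hD2 (ι w) (ι y)]
    abel

end Bianchi

/-! ### The representation of `𝔤𝔩(2)` in the complex basis `z^(k-c) z̄^c`. -/

section Algebra

open MvPolynomial

/-- The exponent of the monomial `x^(k-i) y^i`. -/
def expo (k i : ℕ) : Fin 2 →₀ ℕ := Finsupp.single 0 (k - i) + Finsupp.single 1 i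

/-- The complex version of `coords`. -/
def ccoords (k : ℕ) : MvPolynomial (Fin 2) ℂ →ₗ[ℂ] (Fin (k + 1) → ℂ) :=
  LinearMap.pi fun i => MvPolynomial.lcoeff ℂ (expo k i)

theorem ccoords_apply (k : ℕ) (P : MvPolynomial (Fin 2) ℂ) (i : Fin (k + 1)) :
    ccoords k P i = P.coeff (expo k i) := rfl

/-- The inclusion of `𝕍_k` into its complexification. -/
def complexify (k : ℕ) : V k →ₗ[ℝ] (Fin (k + 1) → ℂ) :=
  LinearMap.pi fun i => Complex.ofRealCLM.toLinearMap ∘ₗ LinearMap.proj i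

theorem complexify_apply (k : ℕ) (v : V k) (i : Fin (k + 1)) : complexify k v i = (v i : ℂ) := rfl

theorem complexify_coords (k : ℕ) (P : MvPolynomial (Fin 2) ℝ) :
    complexify k (coords k P) = ccoords k (map Complex.ofRealHom P) := by
  ext i
  exact (coeff_map Complex.ofRealHom P (expo k i)).symm

/-- The linear form `x + ε y`. -/
def linForm (ε : ℂ) : MvPolynomial (Fin 2) ℂ := X 0 + C ε * X 1

theorem sum_range_two_mul {α : Type*} [AddCommMonoid α] (f : ℕ → α) (n : ℕ) :
    ∑ i ∈ Finset.range (2 * n), f i = ∑ s ∈ Finset.range n, (f (2 * s) + f (2 * s + 1)) := by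
  induction n with
  | zero => simp
  | succ n ih => rw [Nat.mul_succ, Finset.sum_range_succ, Finset.sum_range_succ, ih,
      Finset.sum_range_succ, add_assoc]

/-- The binomial expansion of `(x + ε y)^n`, split by the parity of the exponent of `y`. Allowing
both square roots of `-1` treats `z` and `z̄` at once. -/
theorem map_WEven_add (ε : ℂ) (hε : ε ^ 2 = -1) (n : ℕ) :
    map Complex.ofRealHom (WEven n) + C ε * map Complex.ofRealHom (WOdd n) = linForm ε ^ n := by
  -- The ranges are enlarged to a common length; the added binomial coefficients are zero.
  have h1 : WEven n = ∑ s ∈ Finset.range (n + 1), C ((-1) ^ s * (n.choose (2 * s) : ℝ)) *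
      X 0 ^ (n - 2 * s) * X 1 ^ (2 * s) := by
    refine Finset.sum_subset (Finset.range_mono (by omega)) fun s _ hs => ?_
    rw [Finset.mem_range] at hs
    rw [Nat.choose_eq_zero_of_lt (by omega)]; simp
  have h2 : WOdd n = ∑ s ∈ Finset.range (n + 1), C ((-1) ^ s * (n.choose (2 * s + 1) : ℝ)) *
      X 0 ^ (n - 2 * s - 1) * X 1 ^ (2 * s + 1) := by
    refine Finset.sum_subset (Finset.range_mono (by omega)) fun s _ hs => ?_
    rw [Finset.mem_range] at hs
    rw [Nat.choose_eq_zero_of_lt (by omega)]; simp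
  have h3 : linForm ε ^ n = ∑ i ∈ Finset.range (2 * (n + 1)),
      (C ε * X 1) ^ i * X 0 ^ (n - i) * (n.choose i : MvPolynomial (Fin 2) ℂ) := by
    rw [linForm, add_comm, add_pow]
    refine Finset.sum_subset (Finset.range_mono (by omega)) fun s _ hs => ?_
    rw [Finset.mem_range] at hs
    rw [Nat.choose_eq_zero_of_lt (by omega)]; simp
  rw [h1, h2, h3, sum_range_two_mul, map_sum, map_sum, Finset.mul_sum, ← Finset.sum_add_distrib]
  refine Finset.sum_congr rfl fun s _ => ?_
  have e : (C ε : MvPolynomial (Fin 2) ℂ) ^ (2 * s) = (-1) ^ s := by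
    rw [pow_mul, ← C_pow, hε]; simp
  simp only [map_mul, map_pow, map_X, map_C, mul_pow, pow_succ (C ε), e, Nat.sub_sub]
  simp
  ring

theorem linForm_I_mul : linForm Complex.I * linForm (-Complex.I) = X 0 ^ 2 + X 1 ^ 2 := by
  have : (C Complex.I : MvPolynomial (Fin 2) ℂ) * C Complex.I = -1 := by
    rw [← C_mul, Complex.I_mul_I]; simp
  simp only [linForm, map_neg]
  linear_combination (-(X 1 ^ 2) : MvPolynomial (Fin 2) ℂ) * this

/-- The coordinates of `z^(k-c) z̄^c`, where `z = x + i y`. -/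
def zmon (k c : ℕ) : Fin (k + 1) → ℂ :=
  ccoords k (linForm Complex.I ^ (k - c) * linForm (-Complex.I) ^ c)

theorem complexify_V (k j : ℕ) (ε : ℂ) (hε : ε ^ 2 = -1) :
    complexify k (VEven k j) + ε • complexify k (VOdd k j) =
      ccoords k ((linForm Complex.I * linForm (-Complex.I)) ^ j * linForm ε ^ (k - 2 * j)) := by
  have h : map Complex.ofRealHom ((X 0 ^ 2 + X 1 ^ 2) ^ j * WEven (k - 2 * j)) +
      C ε * map Complex.ofRealHom ((X 0 ^ 2 + X 1 ^ 2) ^ j * WOdd (k - 2 * j)) =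
      (linForm Complex.I * linForm (-Complex.I)) ^ j * linForm ε ^ (k - 2 * j) := by
    rw [linForm_I_mul, ← map_WEven_add ε hε]
    simp only [map_mul, map_pow, map_add, map_X]
    ring
  rw [← h, map_add, ← smul_eq_C_mul, map_smul, VEven, VOdd, complexify_coords, complexify_coords]

theorem complexify_V_I (k j : ℕ) (hj : 2 * j ≤ k) :
    complexify k (VEven k j) + Complex.I • complexify k (VOdd k j) = zmon k j := by
  rw [complexify_V k j _ Complex.I_sq, zmon, mul_pow, show k - j = j + (k - 2 * j) by omega,
    pow_add]
  exact congrArg _ (by ring)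

theorem complexify_V_neg_I (k j : ℕ) (hj : 2 * j ≤ k) :
    complexify k (VEven k j) + (-Complex.I) • complexify k (VOdd k j) = zmon k (k - j) := by
  rw [complexify_V k j _ (by simp), zmon, mul_pow, show k - (k - j) = j by omega,
    show k - j = j + (k - 2 * j) by omega, pow_add]
  exact congrArg _ (by ring)

theorem complexify_VEven (k j : ℕ) (hj : 2 * j ≤ k) :
    complexify k (VEven k j) = (1 / 2 : ℂ) • (zmon k j + zmon k (k - j)) := by
  rw [← complexify_V_I k j hj, ← complexify_V_neg_I k j hj]
  module

theorem complexify_VOdd (k j : ℕ) (hj : 2 * j ≤ k) :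
    complexify k (VOdd k j) = (-Complex.I / 2 : ℂ) • (zmon k j - zmon k (k - j)) := by
  rw [← complexify_V_I k j hj, ← complexify_V_neg_I k j hj]
  have : (-Complex.I / 2 : ℂ) * (2 * Complex.I) = 1 := by
    linear_combination -Complex.I_mul_I
  rw [show complexify k (VEven k j) + Complex.I • complexify k (VOdd k j) -
    (complexify k (VEven k j) + -Complex.I • complexify k (VOdd k j)) =
    (2 * Complex.I) • complexify k (VOdd k j) by module, smul_smul, this, one_smul]

/-- The derivation of the polynomial ring induced by
`x ↦ φ¹₁ x + φ¹₂ y`, `y ↦ φ²₁ x + φ²₂ y`. -/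
def repDer (A : Matrix (Fin 2) (Fin 2) ℝ) :
    Derivation ℂ (MvPolynomial (Fin 2) ℂ) (MvPolynomial (Fin 2) ℂ) :=
  (C (A 0 0 : ℂ) * X 0 + C (A 1 0 : ℂ) * X 1 : MvPolynomial (Fin 2) ℂ) • pderiv 0 +
  (C (A 0 1 : ℂ) * X 0 + C (A 1 1 : ℂ) * X 1 : MvPolynomial (Fin 2) ℂ) • pderiv 1

/-- The complexification of `rep`. -/
def crep (k : ℕ) (A : Matrix (Fin 2) (Fin 2) ℝ) : (Fin (k + 1) → ℂ) →ₗ[ℂ] (Fin (k + 1) → ℂ) :=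
  Matrix.toLin' ((rep k A).map Complex.ofRealHom)

theorem complexify_rep (k : ℕ) (A : Matrix (Fin 2) (Fin 2) ℝ) (v : V k) :
    complexify k ((rep k A).mulVec v) = crep k A (complexify k v) := by
  ext i
  simp [complexify_apply, crep, Matrix.mulVec, dotProduct]

/-- The matrix is tridiagonal. Coefficients are indexed by `ℕ` so that the neighbours `i - 1` and `i
+ 1` can be written without proofs of their bounds. -/
theorem crep_apply (k : ℕ) (A : Matrix (Fin 2) (Fin 2) ℝ) (f : ℕ → ℂ) (i : Fin (k + 1)) :
    crep k A (fun c => f c) i = ((k : ℂ) - (i : ℕ)) * A 0 0 * f i + (i : ℕ) * A 1 1 * f i +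
      (if (i : ℕ) = 0 then 0 else ((k : ℂ) - (i - 1 : ℕ)) * A 1 0 * f (i - 1)) +
      (if (i : ℕ) < k then ((i + 1 : ℕ) : ℂ) * A 0 1 * f (i + 1) else 0) := by
  obtain ⟨i, hi⟩ := i
  have h : ∀ c : Fin (k + 1), ((rep k A).map Complex.ofRealHom ⟨i, hi⟩ c) * f c =
      (fun c : ℕ => (if c = i then ((k : ℂ) - c) * A 0 0 * f c + c * A 1 1 * f c else 0) +
        (if i = c + 1 then ((k : ℂ) - c) * A 1 0 * f c else 0) +
        (if c = i + 1 then c * A 0 1 * f c else 0)) c := by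
    rintro ⟨c, hc⟩
    simp only [rep, Matrix.map_apply, Matrix.of_apply]
    by_cases h1 : i = c
    · subst h1; simp; ring
    by_cases h2 : i = c + 1
    · subst h2; simp
      omega
    by_cases h3 : i + 1 = c
    · subst h3; simp [h2]
    · have h4 : ¬ c = i + 1 := fun h => h3 h.symm
      have h5 : ¬ c = i := fun h => h1 h.symm
      simp [h1, h2, h3, h4, h5]
  simp only [crep, Matrix.toLin'_apply, Matrix.mulVec, dotProduct, h]
  rw [Fin.sum_univ_eq_sum_range (fun c : ℕ => (if c = i then ((k : ℂ) - c) * A 0 0 * f c +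
      c * A 1 1 * f c else 0) + (if i = c + 1 then ((k : ℂ) - c) * A 1 0 * f c else 0) +
        (if c = i + 1 then c * A 0 1 * f c else 0))]
  rw [Finset.sum_add_distrib, Finset.sum_add_distrib, Finset.sum_ite_eq', Finset.sum_ite_eq']
  have h6 : ∑ c ∈ Finset.range (k + 1), (if i = c + 1 then ((k : ℂ) - c) * A 1 0 * f c else 0) =
      if i = 0 then 0 else ((k : ℂ) - (i - 1 : ℕ)) * A 1 0 * f (i - 1) := by
    cases i with
    | zero => simp
    | succ i =>
      simp only [Nat.add_right_cancel_iff, Finset.sum_ite_eq]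
      rw [if_pos (by simp; omega)]; simp
  rw [h6]
  simp [hi]

theorem coeff_expo_X_zero_mul {k i : ℕ} (Q : MvPolynomial (Fin 2) ℂ) :
    (X 0 * Q).coeff (expo k i) = if i < k then Q.coeff (expo (k - 1) i) else 0 := by
  split_ifs with h
  · rw [show expo k i = Finsupp.single 0 1 + expo (k - 1) i by
      rw [expo, expo, ← add_assoc, ← Finsupp.single_add]; congr 2; omega, coeff_X_mul]
  · rw [coeff_X_mul', if_neg]
    simp [expo]; omega

theorem coeff_expo_X_one_mul {k i : ℕ} (hi : i ≤ k) (Q : MvPolynomial (Fin 2) ℂ) :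
    (X 1 * Q).coeff (expo k i) = if i = 0 then 0 else Q.coeff (expo (k - 1) (i - 1)) := by
  split_ifs with h
  · rw [coeff_X_mul', if_neg]
    simp [expo, h]
  · rw [show expo k i = Finsupp.single 1 1 + expo (k - 1) (i - 1) by
      rw [expo, expo, add_left_comm, ← Finsupp.single_add]; congr 2 <;> omega, coeff_X_mul]

theorem coeff_expo_pderiv_zero {k i : ℕ} (hi : i ≤ k) (P : MvPolynomial (Fin 2) ℂ) :
    (pderiv 0 P).coeff (expo k i) = P.coeff (expo (k + 1) i) * ((k - i : ℕ) + 1) := by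
  rw [coeff_pderiv, show expo k i + Finsupp.single 0 1 = expo (k + 1) i by
    rw [expo, expo, add_right_comm, ← Finsupp.single_add]; congr 2; omega]
  simp [expo]

theorem coeff_expo_pderiv_one {k i : ℕ} (P : MvPolynomial (Fin 2) ℂ) :
    (pderiv 1 P).coeff (expo k i) = P.coeff (expo (k + 1) (i + 1)) * (i + 1) := by
  rw [coeff_pderiv, show expo k i + Finsupp.single 1 1 = expo (k + 1) (i + 1) by
    rw [expo, expo, add_assoc, ← Finsupp.single_add]; congr 2; omega]
  simp [expo]

/-- Identifies the explicit matrix with a derivation of the polynomial ring, so that its action on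
`z^(k-c) z̄^c` follows from the Leibniz rule. -/
theorem ccoords_repDer (k : ℕ) (A : Matrix (Fin 2) (Fin 2) ℝ) (P : MvPolynomial (Fin 2) ℂ) :
    ccoords k (repDer A P) = crep k A (ccoords k P) := by
  ext i
  refine Eq.trans ?_ (crep_apply k A (fun c => P.coeff (expo k c)) i).symm
  obtain ⟨i, hi⟩ := i
  rw [ccoords_apply]
  have hik : i ≤ k := by omega
  simp only [repDer, Derivation.add_apply, Derivation.smul_apply, smul_eq_mul, add_mul, coeff_add,
    mul_assoc, coeff_C_mul, coeff_expo_X_zero_mul, coeff_expo_X_one_mul hik, coeff_expo_pderiv_one]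
  rcases Nat.eq_zero_or_pos i with rfl | h0
  · rcases Nat.eq_zero_or_pos k with rfl | hk
    · simp
    · have h1 : k - 1 + 1 = k := by omega
      have h2 : ((k - 1 : ℕ) : ℂ) = k - 1 := by push_cast [hk]; ring
      simp only [hk, if_true, coeff_expo_pderiv_zero (Nat.zero_le _), h1, Nat.sub_zero, h2]
      push_cast; ring
  · have h0' : i ≠ 0 := by omega
    have h1 : k - 1 + 1 = k := by omega
    have h3 : i - 1 + 1 = i := by omega
    have h5 : ((i - 1 : ℕ) : ℂ) = i - 1 := by push_cast [h0]; ring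
    have h6 : k - 1 - (i - 1) = k - i := by omega
    have h7 : ((k - i : ℕ) : ℂ) = k - i := by push_cast [hik]; ring
    simp only [h0', if_false, coeff_expo_pderiv_zero (show i - 1 ≤ k - 1 by omega), h1, h3, h5, h6,
      h7]
    split_ifs with h
    · have h8 : ((k - 1 - i : ℕ) : ℂ) = k - 1 - i := by
        rw [Nat.cast_sub (by omega), Nat.cast_sub (by omega)]; simp
      rw [coeff_expo_pderiv_zero (by omega), h1, h8]
      push_cast; ring
    -- At `i = k` multiplication by `x` contributes nothing, in agreement with the factor `k - i =
    -- 0`.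
    · have h9 : (i : ℂ) = k := by norm_cast; omega
      rw [h9]; ring

/-- The coefficient of `z` in the image of `z = x + i y`. -/
def rho (A : Matrix (Fin 2) (Fin 2) ℝ) : ℂ :=
  (A 0 0 + A 1 1 + Complex.I * (A 0 1 - A 1 0)) / 2

theorem repDer_X_zero (A : Matrix (Fin 2) (Fin 2) ℝ) :
    repDer A (X 0) = C (A 0 0 : ℂ) * X 0 + C (A 1 0 : ℂ) * X 1 := by
  simp [repDer, pderiv_X]

theorem repDer_X_one (A : Matrix (Fin 2) (Fin 2) ℝ) :
    repDer A (X 1) = C (A 0 1 : ℂ) * X 0 + C (A 1 1 : ℂ) * X 1 := by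
  simp [repDer, pderiv_X]

theorem repDer_linForm (A : Matrix (Fin 2) (Fin 2) ℝ) (ε : ℂ) :
    repDer A (linForm ε) = C (A 0 0 + ε * A 0 1) * X 0 + C (A 1 0 + ε * A 1 1) * X 1 := by
  rw [linForm, map_add, Derivation.leibniz, repDer_X_zero, repDer_X_one]
  simp only [smul_eq_mul, map_add, map_mul, ← algebraMap_eq, Derivation.map_algebraMap]
  ring

/-- Up to the factor `i/2`, `ζ` is the `z̄`-coefficient of `A·z`: it measures the failure of `A` to
commute with the rotation structure on the plane. -/
theorem repDer_linForm_I (A : Matrix (Fin 2) (Fin 2) ℝ) :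
    repDer A (linForm Complex.I) = C (rho A) * linForm Complex.I +
      C (Complex.I / 2 * zeta A) * linForm (-Complex.I) := by
  rw [repDer_linForm, linForm, linForm, mul_add, mul_add, ← mul_assoc, ← mul_assoc, ← C_mul,
    ← C_mul, add_add_add_comm, ← add_mul, ← add_mul, ← C_add, ← C_add]
  congr 3
  all_goals
  · rw [rho, zeta]; push_cast
    ring_nf
    simp only [Complex.I_sq, Complex.I_pow_three]
    ring

theorem repDer_linForm_neg_I (A : Matrix (Fin 2) (Fin 2) ℝ) :
    repDer A (linForm (-Complex.I)) = C (star (rho A)) * linForm (-Complex.I) +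
      C (-Complex.I / 2 * star (zeta A)) * linForm Complex.I := by
  rw [repDer_linForm, linForm, linForm, mul_add, mul_add, ← mul_assoc, ← mul_assoc, ← C_mul,
    ← C_mul, add_add_add_comm, ← add_mul, ← add_mul, ← C_add, ← C_add]
  congr 3
  all_goals
  · simp only [rho, zeta, star_add, star_mul', star_div₀, Complex.star_def, Complex.conj_I,
      Complex.conj_ofReal, map_sub, map_ofNat]
    push_cast
    ring_nf
    simp only [Complex.I_sq, Complex.I_pow_three]
    ring

/-- The Leibniz rule: replacing one `z` by `z̄` raises `c`, the opposite replacement lowers it. At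
`c = k` and `c = 0` the out-of-range or truncated index carries the coefficient zero. -/
theorem crep_zmon (k c : ℕ) (hc : c ≤ k) (A : Matrix (Fin 2) (Fin 2) ℝ) :
    crep k A (zmon k c) = (((k : ℂ) - c) * rho A + c * star (rho A)) • zmon k c +
      (((k : ℂ) - c) * (Complex.I / 2 * zeta A)) • zmon k (c + 1) +
      ((c : ℂ) * (-Complex.I / 2 * star (zeta A))) • zmon k (c - 1) := by
  simp only [zmon]
  rw [← ccoords_repDer]
  simp only [← map_smul, ← map_add]
  congr 1
  obtain ⟨a, rfl⟩ := Nat.exists_eq_add_of_le' hc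
  rw [Derivation.leibniz, Derivation.leibniz_pow, Derivation.leibniz_pow, repDer_linForm_I,
    repDer_linForm_neg_I, Nat.add_sub_cancel]
  simp only [smul_eq_C_mul, smul_eq_mul, nsmul_eq_mul]
  rcases a with _ | a <;> rcases c with _ | c
  · simp
  · simp [show c + 1 - c = 1 by omega]
    ring
  · simp
    ring
  · rw [show a + 1 + (c + 1) - (c + 1 + 1) = a by omega,
      show a + 1 + (c + 1) - (c + 1 - 1) = a + 2 by omega]
    simp
    ring

theorem linForm_isHomogeneous (ε : ℂ) : (linForm ε).IsHomogeneous 1 :=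
  (isHomogeneous_X _ _).add (by simpa using (isHomogeneous_C (Fin 2) ε).mul (isHomogeneous_X ℂ 1))

theorem linForm_ne_zero (ε : ℂ) : linForm ε ≠ 0 := by
  intro h
  have := congrArg (fun P => P.coeff (Finsupp.single 0 1)) h
  simp [linForm, coeff_X, Finsupp.single_eq_single_iff] at this

theorem eq_zero_of_ccoords_eq_zero {k : ℕ} {P : MvPolynomial (Fin 2) ℂ} (hP : P.IsHomogeneous k)
    (h : ccoords k P = 0) : P = 0 := by
  ext d
  rw [coeff_zero]
  by_contra hd
  have hdeg : d 0 + d 1 = k := by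
    have := hP hd
    rw [Finsupp.weight_apply, Finsupp.sum_fintype _ _ (by simp)] at this
    simpa using this
  have := congrFun h ⟨d 1, by omega⟩
  rw [ccoords_apply, Pi.zero_apply] at this
  apply hd
  convert this using 2
  ext i
  fin_cases i <;> simp [expo]
  omega

theorem zmon_ne_zero (k c : ℕ) (hc : c ≤ k) : zmon k c ≠ 0 := by
  intro h
  have h1 : (linForm Complex.I ^ (k - c) * linForm (-Complex.I) ^ c).IsHomogeneous k := by
    have := ((linForm_isHomogeneous Complex.I).pow (k - c)).mul
      ((linForm_isHomogeneous (-Complex.I)).pow c)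
    convert this using 1; omega
  exact mul_ne_zero (pow_ne_zero _ (linForm_ne_zero _)) (pow_ne_zero _ (linForm_ne_zero _))
    (eq_zero_of_ccoords_eq_zero h1 h)

/-- The infinitesimal rotation has `ζ = 0` and `rho = -i`, so these are eigenvectors with the
distinct eigenvalues `(2c - k) i`. -/
theorem linearIndependent_zmon (k : ℕ) :
    LinearIndependent ℂ (fun c : Fin (k + 1) => zmon k c) := by
  refine Module.End.eigenvectors_linearIndependent' (crep k !![0, -1; 1, 0])
    (fun c : Fin (k + 1) => (2 * (c : ℕ) - k : ℂ) * Complex.I) ?_ _ ?_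
  · intro a b hab
    have := mul_right_cancel₀ Complex.I_ne_zero hab
    have h2 : ((a : ℕ) : ℂ) = (b : ℕ) := by linear_combination this / 2
    exact Fin.ext (by exact_mod_cast h2)
  · intro c
    refine ⟨?_, zmon_ne_zero k c (by omega)⟩
    rw [Module.End.mem_eigenspace_iff, crep_zmon k c (by omega)]
    have h1 : zeta !![0, -1; 1, 0] = 0 := by simp [zeta]
    have h2 : rho !![0, -1; 1, 0] = -Complex.I := by simp [rho]; ring
    rw [h1, h2]
    simp only [star_zero, mul_zero, zero_smul, add_zero, star_neg, Complex.star_def,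
      Complex.conj_I]
    congr 1; ring

/-- The basis `z^(k-c) z̄^c` of the complexification of `𝕍_k`. -/
def zbasis (k : ℕ) : Module.Basis (Fin (k + 1)) ℂ (Fin (k + 1) → ℂ) :=
  basisOfLinearIndependentOfCardEqFinrank (linearIndependent_zmon k) (by simp)

/-- The coefficient of `z^(k-c) z̄^c`. -/
def zcoeff (k c : ℕ) : (Fin (k + 1) → ℂ) →ₗ[ℂ] ℂ :=
  if h : c < k + 1 then (zbasis k).coord ⟨c, h⟩ else 0

theorem zcoeff_zmon (k c d : ℕ) (hc : c ≤ k) (hd : d ≤ k) :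
    zcoeff k c (zmon k d) = if c = d then 1 else 0 := by
  have h : zmon k d = zbasis k ⟨d, by omega⟩ := by simp [zbasis]
  rw [zcoeff, dif_pos (by omega), h, Module.Basis.coord_apply, Module.Basis.repr_self,
    Finsupp.single_apply]
  simp [eq_comm]

theorem complexify_fromXi (k : ℕ) (c : Fin (k / 2 + 1) → ℂ) :
    complexify k (fromXi k c) = ∑ j : Fin (k / 2 + 1),
      ((star (c j) / 2) • zmon k j + (c j / 2) • zmon k (k - j)) := by
  have h : fromXi k c = ∑ j : Fin (k / 2 + 1),
      ((c j).re • VEven k j + (c j).im • VOdd k j) := by simp [fromXi]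
  rw [h, map_sum]
  refine Finset.sum_congr rfl fun j _ => ?_
  have hj : 2 * (j : ℕ) ≤ k := by omega
  have hr : ∀ (r : ℝ) (v : Fin (k + 1) → ℂ), r • v = (r : ℂ) • v := fun r v => by
    ext i; simp
  rw [map_add, map_smul, map_smul, complexify_VEven k j hj, complexify_VOdd k j hj, hr, hr]
  generalize c j = w
  obtain ⟨a, b⟩ := w
  have h1 : (⟨a, b⟩ : ℂ) = a + b * Complex.I := by apply Complex.ext <;> simp
  have h2 : star (⟨a, b⟩ : ℂ) = a - b * Complex.I := by apply Complex.ext <;> simp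
  dsimp only
  rw [h2, h1]
  module

/-- Oddness of `k` keeps the index ranges `j ≤ k/2` and `k - j > k/2` disjoint, so no conjugate term
contributes to this coefficient. -/
theorem zcoeff_fromXi {k : ℕ} (hk : Odd k) (c : Fin (k / 2 + 1) → ℂ) (j : Fin (k / 2 + 1)) :
    zcoeff k (k - j) (complexify k (fromXi k c)) = c j / 2 := by
  obtain ⟨m, rfl⟩ := hk
  rw [complexify_fromXi, map_sum, Finset.sum_eq_single j]
  · rw [map_add, map_smul, map_smul, zcoeff_zmon _ _ _ (by omega) (by omega),
      zcoeff_zmon _ _ _ (by omega) (by omega), if_neg (by omega), if_pos rfl]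
    simp
  · intro i _ hij
    have : (i : ℕ) ≠ j := fun h => hij (Fin.ext h)
    rw [map_add, map_smul, map_smul, zcoeff_zmon _ _ _ (by omega) (by omega),
      zcoeff_zmon _ _ _ (by omega) (by omega), if_neg (by omega), if_neg (by omega)]
    simp
  · simp

theorem fromXi_isInvertible {k : ℕ} (hk : Odd k) : (fromXi k).IsInvertible := by
  have hinj : Function.Injective (fromXi k) := by
    rw [injective_iff_map_eq_zero]
    intro c hc
    ext j
    have := zcoeff_fromXi hk c j
    rw [hc, map_zero, map_zero] at this
    simpa using this.symm
  have hfin : Module.finrank ℝ (Fin (k / 2 + 1) → ℂ) = Module.finrank ℝ (V k) := by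
    obtain ⟨m, rfl⟩ := hk
    rw [Module.finrank_pi_fintype]
    simp [Complex.finrank_real_complex]
    omega
  exact ⟨(LinearEquiv.ofInjectiveOfFinrankEq (fromXi k).toLinearMap hinj
    hfin).toContinuousLinearEquiv, by ext; rfl⟩

theorem xi_fromXi {k : ℕ} (hk : Odd k) (c : Fin (k / 2 + 1) → ℂ) : xi k (fromXi k c) = c := by
  obtain ⟨e, he⟩ := fromXi_isInvertible hk
  rw [xi, ← he, ContinuousLinearMap.inverse_equiv]; simp

theorem fromXi_xi {k : ℕ} (hk : Odd k) (v : V k) : fromXi k (xi k v) = v := by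
  obtain ⟨e, he⟩ := fromXi_isInvertible hk
  rw [xi, ← he, ContinuousLinearMap.inverse_equiv]; simp

theorem xi_VEven {k : ℕ} (hk : Odd k) (j : Fin (k / 2 + 1)) : xi k (VEven k j) = Pi.single j 1 := by
  rw [← xi_fromXi hk (Pi.single j 1)]
  congr 1
  simp [fromXi, Pi.single_apply, apply_ite Complex.re, apply_ite Complex.im, ite_smul]

theorem xi_VOdd {k : ℕ} (hk : Odd k) (j : Fin (k / 2 + 1)) : xi k (VOdd k j) = Pi.single j Complex.I := by
  rw [← xi_fromXi hk (Pi.single j Complex.I)]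
  congr 1
  simp [fromXi, Pi.single_apply, apply_ite Complex.re, apply_ite Complex.im, ite_smul]

/-- With `k = 2m+1`, `ξ^{m-1}` sits at index `c = m+2`. Its neighbours `m+1`, `m+2`, `m+3` all lie
on the holomorphic side `c > m`, so no `ξ̄^j` enters. The coefficient of `ξ^m` comes from raising `c
= m+1`, which contributes the factor `k - c = m`. -/
theorem xi_rep {k : ℕ} (hk : Odd k) (hk1 : 1 < k) (A : Matrix (Fin 2) (Fin 2) ℝ) : ∃ r : Fin (k / 2 + 1) → ℂ,
    r (Fin.last _) = (k / 2 : ℕ) * (Complex.I / 2 * zeta A) ∧ ∀ v : V k,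
      xi k ((rep k A).mulVec v) ⟨k / 2 - 1, by omega⟩ = ∑ j, xi k v j * r j := by
  set i : Fin (k / 2 + 1) := ⟨k / 2 - 1, by omega⟩ with hi
  have hx : ∀ w : V k, xi k w i = 2 * zcoeff k (k - i) (complexify k w) := by
    intro w
    have := zcoeff_fromXi hk (xi k w) i
    rw [fromXi_xi hk] at this
    rw [this]; ring
  refine ⟨fun j => zcoeff k (k - i) (crep k A (zmon k (k - j))), ?_, ?_⟩
  · obtain ⟨m, rfl⟩ := hk
    have h1 : (2 * m + 1) / 2 = m := by omega
    simp only [hi, h1, Fin.val_last]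
    rw [crep_zmon _ _ (by omega), map_add, map_add, map_smul, map_smul, map_smul,
      zcoeff_zmon _ _ _ (by omega) (by omega), zcoeff_zmon _ _ _ (by omega) (by omega),
      zcoeff_zmon _ _ _ (by omega) (by omega), if_neg (by omega), if_pos (by omega),
      if_neg (by omega), show 2 * m + 1 - m = m + 1 by omega]
    push_cast
    simp only [smul_eq_mul]
    ring
  · intro v
    rw [hx, complexify_rep]
    conv_lhs => rw [← fromXi_xi hk v, complexify_fromXi]
    rw [map_sum, map_sum, Finset.mul_sum]
    refine Finset.sum_congr rfl fun j _ => ?_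
    -- The conjugate coordinates sit at `c = j ≤ m`, which one application of `A` brings to at most
    -- `m+1 < m+2`.
    have h0 : zcoeff k (k - i) (crep k A (zmon k j)) = 0 := by
      obtain ⟨m, rfl⟩ := hk
      have h1 : (2 * m + 1) / 2 = m := by omega
      have := j.2
      simp only [hi, h1] at this ⊢
      rw [crep_zmon _ _ (by omega), map_add, map_add, map_smul, map_smul, map_smul,
        zcoeff_zmon _ _ _ (by omega) (by omega), zcoeff_zmon _ _ _ (by omega) (by omega),
        zcoeff_zmon _ _ _ (by omega) (by omega), if_neg (by omega), if_neg (by omega),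
        if_neg (by omega)]
      simp
    simp only [map_add, map_smul, h0, smul_eq_mul]
    ring

end Algebra

/-! ### Types of forms and the algebraic core of the theorem. -/

section ComplexStructure

/-- The complex structure on `𝕍_k` for which `xi` is complex linear. -/
def mulI (k : ℕ) : V k →L[ℝ] V k := (fromXi k).comp (Complex.I • xi k)

theorem xi_mulI {k : ℕ} (hk : Odd k) (v : V k) : xi k (mulI k v) = Complex.I • xi k v := by
  simp only [mulI, ContinuousLinearMap.comp_apply, xi_fromXi hk]; rfl

theorem xi_injective {k : ℕ} (hk : Odd k) : Function.Injective (xi k) :=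
  Function.LeftInverse.injective (fromXi_xi hk)

theorem mulI_VEven {k : ℕ} (hk : Odd k) (j : Fin (k / 2 + 1)) :
    mulI k (VEven k j) = VOdd k j := by
  apply xi_injective hk
  rw [xi_mulI hk, xi_VEven hk, xi_VOdd hk, ← Pi.single_smul]; simp

theorem mulI_mulI {k : ℕ} (hk : Odd k) (v : V k) : mulI k (mulI k v) = - v := by
  apply xi_injective hk
  rw [xi_mulI hk, xi_mulI hk, smul_smul, Complex.I_mul_I, map_neg]; simp

theorem linearMap_eq_zero_of_V {k : ℕ} (hk : Odd k) {W : Type*} [AddCommGroup W] [Module ℝ W]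
    (f : V k →ₗ[ℝ] W) (h0 : ∀ j : Fin (k / 2 + 1), f (VEven k j) = 0)
    (h1 : ∀ j : Fin (k / 2 + 1), f (VOdd k j) = 0) : f = 0 := by
  refine LinearMap.ext fun v => ?_
  rw [← fromXi_xi hk v]
  simp [fromXi, h0, h1]

/-- A bilinear form of type `(2,0)` is complex linear. -/
theorem mulI_of_comp {k : ℕ} (hk : Odd k) (B : V k →ₗ[ℝ] V k →ₗ[ℝ] V k)
    (h11 : ∀ j a b, comp11 k (fun v w => xi k (B v w) j) a b = 0)
    (h02 : ∀ j a b, comp02 k (fun v w => xi k (B v w) j) a b = 0) (v w : V k) :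
    B v (mulI k w) = mulI k (B v w) := by
  -- The sum of the two vanishing coefficients gives linearity for even first argument; their
  -- difference gives it for odd first argument below.
  have he : ∀ a b : Fin (k / 2 + 1),
      B (VEven k a) (VOdd k b) = mulI k (B (VEven k a) (VEven k b)) := fun a b => by
    apply xi_injective hk
    ext j
    have h1 := h11 j a b
    have h2 := h02 j a b
    simp only [comp11, comp02] at h1 h2
    rw [xi_mulI hk, Pi.smul_apply, smul_eq_mul]
    linear_combination (-2 * Complex.I) * h1 + (-2 * Complex.I) * h2 +
      (xi k (B (VEven k a) (VOdd k b)) j) * Complex.I_mul_I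
  have ho : ∀ a b : Fin (k / 2 + 1),
      B (VOdd k a) (VOdd k b) = mulI k (B (VOdd k a) (VEven k b)) := fun a b => by
    apply xi_injective hk
    ext j
    have h1 := h11 j a b
    have h2 := h02 j a b
    simp only [comp11, comp02] at h1 h2
    rw [xi_mulI hk, Pi.smul_apply, smul_eq_mul]
    linear_combination 2 * h1 - 2 * h2
  have hB : ∀ x : V k, (∀ b : Fin (k / 2 + 1), B x (VOdd k b) = mulI k (B x (VEven k b))) →
      ∀ y, B x (mulI k y) = mulI k (B x y) := fun x hx y => by
    have := linearMap_eq_zero_of_V hk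
      ((B x) ∘ₗ (mulI k).toLinearMap - (mulI k).toLinearMap ∘ₗ (B x)) ?_ ?_
    · exact sub_eq_zero.mp (DFunLike.congr_fun this y)
    · intro j; simp [mulI_VEven hk, hx]
    · intro j; simp [← mulI_VEven hk, mulI_mulI hk]
      rw [mulI_VEven hk, hx j, mulI_mulI hk]; simp
  have := linearMap_eq_zero_of_V hk
    (B.flip (mulI k w) - (mulI k).toLinearMap ∘ₗ (B.flip w)) ?_ ?_
  · exact sub_eq_zero.mp (DFunLike.congr_fun this v)
  · intro j; simp [hB _ (he j)]
  · intro j; simp [hB _ (ho j)]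

/-- If the cyclic sum `Ω ∧ ω` has no component of type `(1,2)`, then the `(0,2)`-part of `ζ(Ω)`
vanishes. -/
theorem comp02_zeta_eq_zero {k : ℕ} (hk : Odd k) (hk1 : 1 < k)
    (O : V k → V k → Matrix (Fin 2) (Fin 2) ℝ) (T : V k → V k → V k → V k)
    (hTJ : ∀ x y w, T x y (mulI k w) = mulI k (T x y w)) (hTs : ∀ x y w, T x w y = - T x y w)
    (h : ∀ x y w, (rep k (O x y)).mulVec w + (rep k (O y w)).mulVec x +
      (rep k (O w x)).mulVec y = T x y w + T y w x + T w x y) (a b : Fin (k / 2 + 1)) :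
    comp02 k (fun v w => zeta (O v w)) a b = 0 := by
  set i : Fin (k / 2 + 1) := ⟨k / 2 - 1, by omega⟩ with hi
  choose r hr hrv using fun A => xi_rep hk hk1 A
  have hℓJ : ∀ A w, xi k ((rep k A).mulVec (mulI k w)) i =
      Complex.I * xi k ((rep k A).mulVec w) i := fun A w => by
    rw [hrv, hrv, xi_mulI hk, Finset.mul_sum]
    simp [mul_assoc]
  have hℓ : ∀ A, xi k ((rep k A).mulVec (VEven k (Fin.last (k / 2) : Fin (k / 2 + 1)))) i =
      (k / 2 : ℕ) * (Complex.I / 2 * zeta A) := fun A => by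
    rw [hrv, xi_VEven hk, ← hr A]
    simp [Pi.single_apply]
  have ht : ∀ x y w, xi k (T x y (mulI k w)) i = Complex.I * xi k (T x y w) i := fun x y w => by
    rw [hTJ, xi_mulI hk]; rfl
  have ht' : ∀ x y w, xi k (T x (mulI k y) w) i = Complex.I * xi k (T x y w) i := fun x y w => by
    rw [hTs x w, map_neg, Pi.neg_apply, ht, hTs x y w, map_neg, Pi.neg_apply]; ring
  have E : ∀ x y w, _ := fun x y w => congrFun (congrArg (xi k) (h x y w)) i
  simp only [map_add, Pi.add_apply] at E
  -- A real `x` suffices: the torsion terms already vanish by the types of `ȳ` and `w̄`, and `ξ^m`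
  -- is its only nonzero coordinate.
  set x := VEven k (Fin.last (k / 2) : Fin (k / 2 + 1))
  set y := VEven k a
  set w := VEven k b
  have E1 := E x y w
  have E2 := E x y (mulI k w)
  have E3 := E x (mulI k y) w
  have E4 := E x (mulI k y) (mulI k w)
  simp only [hℓJ, ht, ht', hℓ, x] at E1 E2 E3 E4
  have hk2 : ((k / 2 : ℕ) : ℂ) ≠ 0 := by
    have : k / 2 ≠ 0 := by omega
    exact_mod_cast this
  -- The combination of `E1` to `E4` is the evaluation at `(x, y + iJy, w + iJw)`. It kills every
  -- term `J`-linear in `y` or in `w`, leaving `4 · m (i/2)` times the `(0,2)`-coefficient.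
  have hc : ((k / 2 : ℕ) * Complex.I * 2) * comp02 k (fun v w => zeta (O v w)) a b = 0 := by
    simp only [comp02, ← mulI_VEven hk]
    linear_combination (norm := (ring_nf; simp only [Complex.I_sq]; ring))
      E1 + Complex.I * E2 + Complex.I * E3 - E4
  simpa [hk2] using hc

theorem comp02_self_eq_zero (k : ℕ) (β : V k → V k → ℂ) (hβ : ∀ v w, β w v = - β v w)
    (a : Fin (k / 2 + 1)) : comp02 k β a a = 0 := by
  have h1 : ∀ v, β v v = 0 := fun v => by
    linear_combination (1 / 2 : ℂ) * hβ v v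
  rw [comp02, h1, h1, hβ (VEven k a) (VOdd k a)]
  ring

end ComplexStructure

/-! ### Symmetric powers and the infinitesimal action on monomials. -/

section SymmetricPowers

theorem hasDerivAt_multilinear {ι E W : Type*} [Fintype ι] [DecidableEq ι] [AddCommGroup E]
    [Module ℝ E] [NormedAddCommGroup W] [NormedSpace ℝ W] (g : MultilinearMap ℝ (fun _ : ι => E) W)
    (a b : ι → E) :
    HasDerivAt (fun t : ℝ => g (fun i => a i + t • b i))
      (∑ i, g (Function.update a i (b i))) 0 := by
  -- `E` carries no topology, so each slot is restricted to the plane of combinations of `a i` and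
  -- `b i`; a multilinear map on copies of `ℝ × ℝ` is continuous, hence differentiable.
  let h₀ : MultilinearMap ℝ (fun _ : ι => ℝ × ℝ) W := g.compLinearMap fun i =>
    (LinearMap.fst ℝ ℝ ℝ).smulRight (a i) + (LinearMap.snd ℝ ℝ ℝ).smulRight (b i)
  have hc : Continuous h₀ := by
    have : ∀ p, h₀ p = ∑ s : Finset ι, (∏ i, s.piecewise (fun i => (p i).1) (fun i => (p i).2) i) •
        g (s.piecewise a b) := fun p => by
      refine (g.map_add_univ (fun i => (p i).1 • a i) (fun i => (p i).2 • b i)).trans ?_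
      refine Finset.sum_congr rfl fun s _ => ?_
      rw [← g.map_smul_univ]
      congr 1
      ext i
      by_cases hi : i ∈ s <;> simp [hi]
    rw [show (h₀ : (ι → ℝ × ℝ) → W) = _ from funext this]
    refine continuous_finsetSum _ fun s _ => Continuous.smul ?_ continuous_const
    refine continuous_finsetProd _ fun i _ => ?_
    by_cases hi : i ∈ s <;> simp [hi] <;> fun_prop
  let h : ContinuousMultilinearMap ℝ (fun _ : ι => ℝ × ℝ) W := ⟨h₀, hc⟩
  have hh : ∀ p, h p = g (fun i => (p i).1 • a i + (p i).2 • b i) := fun p => rfl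
  have h1 := h.hasFDerivAt (fun _ => ((1 : ℝ), (0 : ℝ)))
  have h2 : HasDerivAt (fun t : ℝ => fun _ : ι => ((1 : ℝ), t)) (fun _ => ((0 : ℝ), (1 : ℝ))) 0 :=
    hasDerivAt_pi.2 fun _ => (hasDerivAt_const _ _).prodMk (hasDerivAt_id _)
  have h3 := h1.comp_hasDerivAt (0 : ℝ) h2
  convert h3 using 1
  · ext t; simp [hh]
  · rw [ContinuousMultilinearMap.linearDeriv_apply]
    refine Finset.sum_congr rfl fun i _ => ?_
    rw [hh]
    congr 1
    ext j
    by_cases hj : j = i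
    · subst hj; simp
    · simp [hj]

variable {E : Type*} [AddCommGroup E] [Module ℝ E]

/-- The monomial `x^(k-n) y^n` in the symmetric power. -/
def symMonomial (k n : ℕ) (x y : E) : Sym[ℝ]^k E :=
  SymmetricPower.tprod ℝ fun m : Fin k => if (m : ℕ) < k - n then x else y

theorem tprod_ite_eq_symMonomial {k n : ℕ} (s : Finset (Fin k)) (hn : s.card + n = k) (x y : E) :
    SymmetricPower.tprod ℝ (fun m : Fin k => if m ∈ s then x else y) = symMonomial k n x y := by
  obtain ⟨e, he⟩ := Equiv.Perm.exists_map_finset_eq s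
    (Finset.univ.filter fun m : Fin k => (m : ℕ) < k - n) (by
      rw [Fin.card_filter_val_lt]; omega)
  refine Eq.trans ?_ (SymmetricPower.tprod_equiv e _)
  congr 1
  ext m
  have : m ∈ s ↔ ((e m : Fin k) : ℕ) < k - n := by
    have h1 : e m ∈ s.map e.toEmbedding ↔ m ∈ s := by simp
    rw [← h1, he]; simp
  exact if_congr this rfl rfl

theorem tprod_add_eq_sum (k : ℕ) (x y : E) (c : Fin k → Fin 2 → ℝ) :
    SymmetricPower.tprod ℝ (fun m => c m 0 • x + c m 1 • y) =
      ∑ r : Fin k → Fin 2, (∏ m, c m (r m)) •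
        SymmetricPower.tprod ℝ fun m => if r m = 0 then x else y := by
  have := (SymmetricPower.tprod ℝ (ι := Fin k) (M := E)).map_sum
    (fun m (j : Fin 2) => c m j • if j = 0 then x else y)
  simp only [Fin.sum_univ_two] at this
  simp only [MultilinearMap.map_smul_univ] at this
  simpa using this

theorem exists_tprod_eq_symMonomial (k : ℕ) (x y : E) (r : Fin k → Fin 2) :
    ∃ i : Fin (k + 1), SymmetricPower.tprod ℝ (fun m => if r m = 0 then x else y) =
      symMonomial k i x y := by
  have hle : (Finset.univ.filter fun m => r m = 0).card ≤ k :=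
    (Finset.card_le_univ _).trans (by simp)
  refine ⟨⟨k - (Finset.univ.filter fun m => r m = 0).card, by omega⟩, ?_⟩
  rw [← tprod_ite_eq_symMonomial (Finset.univ.filter fun m => r m = 0)]
  · simp
  · simp only; omega

theorem span_symMonomial (k : ℕ) {x y : E} (h : ∀ v : E, ∃ a b : ℝ, v = a • x + b • y) :
    Submodule.span ℝ (Set.range fun i : Fin (k + 1) => symMonomial k i x y) = ⊤ := by
  rw [eq_top_iff, ← SymmetricPower.span_tprod_eq_top, Submodule.span_le]
  rintro _ ⟨v, rfl⟩
  choose a b hab using fun m => h (v m)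
  have hv : v = fun m => ![a m, b m] 0 • x + ![a m, b m] 1 • y := by
    ext m; simpa using hab m
  rw [hv, tprod_add_eq_sum k x y (fun m => ![a m, b m])]
  refine Submodule.sum_mem _ fun r _ => Submodule.smul_mem _ _ ?_
  obtain ⟨i, hi⟩ := exists_tprod_eq_symMonomial k x y r
  rw [hi]
  exact Submodule.subset_span ⟨i, rfl⟩

/-- The derivative of a monomial along a generator of the right action is given by `rep`. -/
theorem hasDerivAt_symMonomial {W : Type*} [NormedAddCommGroup W] [NormedSpace ℝ W] (k : ℕ)
    (f : Sym[ℝ]^k E →ₗ[ℝ] W) (x y : E) (A : Matrix (Fin 2) (Fin 2) ℝ) (i : Fin (k + 1)) :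
    HasDerivAt (fun t : ℝ => f (symMonomial k i (x + t • (A 0 0 • x + A 1 0 • y))
      (y + t • (A 0 1 • x + A 1 1 • y))))
      (∑ r : Fin (k + 1), rep k A r i • f (symMonomial k r x y)) 0 := by
  set P : ℕ → W := fun n => f (symMonomial k n x y) with hP
  set g := f.compMultilinearMap (SymmetricPower.tprod ℝ (ι := Fin k) (M := E)) with hg
  have h1 := hasDerivAt_multilinear g (fun m : Fin k => if (m : ℕ) < k - i then x else y)
    (fun m : Fin k => if (m : ℕ) < k - i then A 0 0 • x + A 1 0 • y else A 0 1 • x + A 1 1 • y)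
  have hfun : (fun t : ℝ => f (symMonomial k i (x + t • (A 0 0 • x + A 1 0 • y))
      (y + t • (A 0 1 • x + A 1 1 • y)))) = fun t : ℝ => g (fun m : Fin k =>
        (if (m : ℕ) < k - i then x else y) +
        t • (if (m : ℕ) < k - i then A 0 0 • x + A 1 0 • y else A 0 1 • x + A 1 1 • y)) := by
    ext t
    simp only [hg, symMonomial, LinearMap.compMultilinearMap_apply]
    congr 2
    ext m
    split_ifs <;> rfl
  rw [hfun]
  convert h1 using 1
  have hupd : ∀ (m : Fin k) (v : E) (s : Finset (Fin k)) (n : ℕ), s.card + n = k →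
      (∀ m', Function.update (fun m : Fin k => if (m : ℕ) < k - i then x else y) m v m' =
        if m' ∈ s then x else y) →
      g (Function.update (fun m : Fin k => if (m : ℕ) < k - i then x else y) m v) = P n := by
    intro m v s n hn h
    rw [show Function.update (fun m : Fin k => if (m : ℕ) < k - i then x else y) m v = _ from
      funext h]
    exact congrArg f (tprod_ite_eq_symMonomial s hn x y)
  -- The `k - i` slots holding `x`. A substitution of `y` in one of them gives the monomial `i + 1`,
  -- a substitution of `x` in a slot outside gives `i - 1`; counting slots produces the entries of
  -- `rep`.
  set S : Finset (Fin k) := Finset.univ.filter fun m : Fin k => (m : ℕ) < k - i with hS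
  have hSc : S.card = k - i := by rw [hS, Fin.card_filter_val_lt]; omega
  have hmem : ∀ m, m ∈ S ↔ (m : ℕ) < k - i := fun m => by simp [hS]
  have hik : (i : ℕ) ≤ k := by omega
  have hterm : ∀ m : Fin k, g (Function.update (fun m : Fin k => if (m : ℕ) < k - i then x else y) m
      (if (m : ℕ) < k - i then A 0 0 • x + A 1 0 • y else A 0 1 • x + A 1 1 • y)) =
      if m ∈ S then A 0 0 • P i + A 1 0 • P (i + 1) else A 0 1 • P (i - 1) + A 1 1 • P i := by
    intro m
    by_cases hm : (m : ℕ) < k - i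
    · rw [if_pos hm, if_pos ((hmem m).2 hm), MultilinearMap.map_update_add,
        MultilinearMap.map_update_smul, MultilinearMap.map_update_smul,
        hupd m x S i (by omega) ?_, hupd m y (S.erase m) (i + 1) ?_ ?_]
      · rw [Finset.card_erase_of_mem ((hmem m).2 hm)]; omega
      · intro m'
        by_cases hmm : m' = m
        · subst hmm; simp
        · simp [hmm, hmem]
      · intro m'
        by_cases hmm : m' = m
        · subst hmm; simp [hmem, hm]
        · simp [hmm, hmem]
    · have hm' : m ∉ S := fun h => hm ((hmem m).1 h)
      rw [if_neg hm, if_neg hm', MultilinearMap.map_update_add,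
        MultilinearMap.map_update_smul, MultilinearMap.map_update_smul,
        hupd m x (insert m S) (i - 1) ?_ ?_, hupd m y S i (by omega) ?_]
      · intro m'
        by_cases hmm : m' = m
        · subst hmm; simp [hm']
        · simp [hmm, hmem]
      · rw [Finset.card_insert_of_notMem hm']; omega
      · intro m'
        by_cases hmm : m' = m
        · subst hmm; simp
        · simp [hmm, hmem]
  rw [Finset.sum_congr rfl fun m _ => hterm m, Finset.sum_ite]
  have hc1 : (Finset.univ.filter fun m => m ∈ S) = S := by ext; simp
  have hc2 : (Finset.univ.filter fun m => m ∉ S) = Sᶜ := by ext; simp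
  rw [hc1, hc2, Finset.sum_const, Finset.sum_const, Finset.card_compl, hSc, Fintype.card_fin,
    Nat.sub_sub_self hik]
  obtain ⟨i, hi⟩ := i
  simp only at hik ⊢
  have hsplit : ∀ r : Fin (k + 1), rep k A r ⟨i, hi⟩ • f (symMonomial k r x y) =
      (fun r : ℕ => (if r = i then (((k : ℝ) - i) * A 0 0 + i * A 1 1) • P r else 0) +
        (if r = i + 1 then (((k : ℝ) - i) * A 1 0) • P r else 0) +
        (if i = r + 1 then ((i : ℝ) * A 0 1) • P r else 0)) r := by
    rintro ⟨r, hr⟩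
    simp only [rep, Matrix.of_apply, hP]
    by_cases h1 : r = i
    · subst h1; simp
    by_cases h2 : r = i + 1
    · subst h2; simp
      omega
    by_cases h3 : r + 1 = i
    · subst h3; simp [h2]
    · simp [h1, h2, h3, Ne.symm h3]
  rw [Finset.sum_congr rfl fun r _ => hsplit r, Fin.sum_univ_eq_sum_range (fun r : ℕ =>
    (if r = i then (((k : ℝ) - i) * A 0 0 + i * A 1 1) • P r else 0) +
        (if r = i + 1 then (((k : ℝ) - i) * A 1 0) • P r else 0) +
        (if i = r + 1 then ((i : ℝ) * A 0 1) • P r else 0)), Finset.sum_add_distrib,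
    Finset.sum_add_distrib, Finset.sum_ite_eq', Finset.sum_ite_eq', if_pos (by simpa using hi)]
  -- For `i = k` the neighbour does not exist, and its coefficient `k - i` is zero.
  have e1 : (if i + 1 ∈ Finset.range (k + 1) then (((k : ℝ) - i) * A 1 0) • P (i + 1) else 0) =
      (((k : ℝ) - i) * A 1 0) • P (i + 1) := by
    split_ifs with h
    · rfl
    · have : (k : ℝ) = i := by
        rw [Finset.mem_range] at h; norm_cast; omega
      rw [this]; simp
  have e2 : ∑ r ∈ Finset.range (k + 1), (if i = r + 1 then ((i : ℝ) * A 0 1) • P r else 0) =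
      ((i : ℝ) * A 0 1) • P (i - 1) := by
    cases i with
    | zero => simp
    | succ i =>
      simp only [Nat.add_right_cancel_iff, Finset.sum_ite_eq]
      rw [if_pos (by simp; omega)]; simp
  rw [e1, e2, ← Nat.cast_smul_eq_nsmul ℝ, ← Nat.cast_smul_eq_nsmul ℝ, Nat.cast_sub hik]
  module

end SymmetricPowers

/-! ### Independence of the exterior derivative from the chart. -/

section Charts

variable {EN : Type*} [NormedAddCommGroup EN] [NormedSpace ℝ EN] {HN : Type*} [TopologicalSpace HN]
  {J : ModelWithCorners ℝ EN HN} {N : Type*} [TopologicalSpace N] [ChartedSpace HN N]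

/-- All tangent spaces are by definition the model space, so the same `X` can be read at two points
that are only propositionally equal. -/
theorem oneForm_apply_congr (η : OneForm J N) {p q : N} (h : p = q) (X : EN) :
    η p X = η q X := by subst h; rfl

variable [IsManifold J ∞ N]

theorem mdifferentiableAt_extChartAt_of_mem {u w : N} (hw : w ∈ (extChartAt J u).source) :
    MDifferentiableAt J 𝓘(ℝ, EN) (extChartAt J u) w := by
  have : IsManifold J 1 N := IsManifold.of_le (n := ∞) (by simp)
  exact mdifferentiableAt_extChartAt (by rwa [extChartAt_source] at hw)

variable [J.Boundaryless]

theorem mdifferentiableAt_extChartAt_symm {u : N} {z : EN} (hz : z ∈ (extChartAt J u).target) :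
    MDifferentiableAt 𝓘(ℝ, EN) J (extChartAt J u).symm z := by
  have : IsManifold J 1 N := IsManifold.of_le (n := ∞) (by simp)
  have := mdifferentiableWithinAt_extChartAt_symm (I := J) hz
  rwa [J.range_eq_univ, mdifferentiableWithinAt_univ] at this

theorem mfderiv_extChartAt_mfderiv_symm {u : N} {z : EN} (hz : z ∈ (extChartAt J u).target)
    (X : EN) : mfderiv J 𝓘(ℝ, EN) (extChartAt J u) ((extChartAt J u).symm z)
      (mfderiv 𝓘(ℝ, EN) J (extChartAt J u).symm z X) = X := by
  have : IsManifold J 1 N := IsManifold.of_le (n := ∞) (by simp)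
  have := mfderiv_extChartAt_comp_mfderivWithin_extChartAt_symm (I := J) hz
  rw [J.range_eq_univ, mfderivWithin_univ] at this
  exact DFunLike.congr_fun this X

theorem mfderiv_symm_mfderiv_extChartAt {u w : N} (hw : w ∈ (extChartAt J u).source)
    (X : TangentSpace J w) : mfderiv 𝓘(ℝ, EN) J (extChartAt J u).symm (extChartAt J u w)
      (mfderiv J 𝓘(ℝ, EN) (extChartAt J u) w X) = X := by
  have : IsManifold J 1 N := IsManifold.of_le (n := ∞) (by simp)
  have := mfderivWithin_extChartAt_symm_comp_mfderiv_extChartAt' (I := J) hw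
  rw [J.range_eq_univ, mfderivWithin_univ] at this
  exact DFunLike.congr_fun this X

theorem contDiffAt_coordChange {u w : N} (hw : w ∈ (extChartAt J u).source) :
    ContDiffAt ℝ ∞ (extChartAt J u ∘ (extChartAt J w).symm) (extChartAt J w w) := by
  have := contDiffWithinAt_ext_coord_change (I := J) (n := ∞) u w (y := extChartAt J w w) (by
    rw [PartialEquiv.trans_source, PartialEquiv.symm_source]
    exact ⟨mem_extChartAt_target w, by
      simpa only [Set.mem_preimage, extChartAt_to_inv] using hw⟩)
  rwa [J.range_eq_univ, contDiffWithinAt_univ] at this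

/-- The transformation of the coefficients of a one-form under a change of charts. -/
theorem OneForm.inChart_coordChange (η : OneForm J N) {u w : N} {z : EN}
    (hz : z ∈ (extChartAt J w).target) (hzu : (extChartAt J w).symm z ∈ (extChartAt J u).source)
    (X : EN) :
    η.inChart w z X = η.inChart u ((extChartAt J u ∘ (extChartAt J w).symm) z)
      (fderiv ℝ (extChartAt J u ∘ (extChartAt J w).symm) z X) := by
  set T := extChartAt J u ∘ (extChartAt J w).symm with hT
  have hTz : (extChartAt J u).symm (T z) = (extChartAt J w).symm z :=
    (extChartAt J u).left_inv hzu
  have hmT : MDifferentiableAt 𝓘(ℝ, EN) 𝓘(ℝ, EN) T z :=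
    (mdifferentiableAt_extChartAt_of_mem hzu).comp z (mdifferentiableAt_extChartAt_symm hz)
  have hms : MDifferentiableAt 𝓘(ℝ, EN) J (extChartAt J u).symm (T z) :=
    mdifferentiableAt_extChartAt_symm ((extChartAt J u).map_source hzu)
  have hev : (extChartAt J w).symm =ᶠ[𝓝 z] (extChartAt J u).symm ∘ T := by
    have h1 : ∀ᶠ y in 𝓝 z, (extChartAt J w).symm y ∈ (extChartAt J u).source :=
      (mdifferentiableAt_extChartAt_symm hz).continuousAt.eventually
        ((isOpen_extChartAt_source u).mem_nhds hzu)
    filter_upwards [h1] with y hy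
    exact ((extChartAt J u).left_inv hy).symm
  have hd : (mfderiv 𝓘(ℝ, EN) J (extChartAt J w).symm z : EN →L[ℝ] EN) X =
      (mfderiv 𝓘(ℝ, EN) J (extChartAt J u).symm (T z) : EN →L[ℝ] EN) (fderiv ℝ T z X) := by
    have h2 := hev.mfderiv_eq (I := 𝓘(ℝ, EN)) (I' := J)
    have h3 := mfderiv_comp z hms hmT
    rw [mfderiv_eq_fderiv] at h3
    exact (DFunLike.congr_fun (show (mfderiv 𝓘(ℝ, EN) J (extChartAt J w).symm z : EN →L[ℝ] EN) =
      mfderiv 𝓘(ℝ, EN) J ((extChartAt J u).symm ∘ T) z from h2) X).trans (DFunLike.congr_fun h3 X)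
  change η ((extChartAt J w).symm z) (mfderiv 𝓘(ℝ, EN) J (extChartAt J w).symm z X) =
    η ((extChartAt J u).symm (T z)) (mfderiv 𝓘(ℝ, EN) J (extChartAt J u).symm (T z)
      (fderiv ℝ T z X))
  exact (congrArg (η ((extChartAt J w).symm z)) hd).trans (oneForm_apply_congr η hTz.symm _)

/-- The exterior derivative can be computed in any chart. -/
theorem OneForm.d_eq (η : OneForm J N) {u w : N} (hw : w ∈ (extChartAt J u).source)
    (hη : DifferentiableAt ℝ (η.inChart u) (extChartAt J u w)) (X Y : TangentSpace J w) :
    η.d w X Y =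
      fderiv ℝ (η.inChart u) (extChartAt J u w) (mfderiv J 𝓘(ℝ, EN) (extChartAt J u) w X)
        (mfderiv J 𝓘(ℝ, EN) (extChartAt J u) w Y) -
      fderiv ℝ (η.inChart u) (extChartAt J u w) (mfderiv J 𝓘(ℝ, EN) (extChartAt J u) w Y)
        (mfderiv J 𝓘(ℝ, EN) (extChartAt J u) w X) := by
  set T := extChartAt J u ∘ (extChartAt J w).symm with hT
  set z := extChartAt J w w with hz
  have hzt : z ∈ (extChartAt J w).target := mem_extChartAt_target w
  have hsz : (extChartAt J w).symm z = w := extChartAt_to_inv w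
  have hTz : T z = extChartAt J u w := by simp only [hT, Function.comp_apply, hsz]
  have hTd : ContDiffAt ℝ ∞ T z := contDiffAt_coordChange hw
  have hT1 : DifferentiableAt ℝ T z := hTd.differentiableAt (by simp)
  have hT2 : DifferentiableAt ℝ (fderiv ℝ T) z :=
    ((hTd.of_le (m := 2) ENat.LEInfty.out).fderiv_right (m := 1) (by norm_num)).differentiableAt
      (by norm_num)
  -- The transformation rule for the coefficients contributes a second derivative of the transition
  -- map, which is symmetric and drops out after skew-symmetrization.
  have hsym : ∀ a b, fderiv ℝ (fderiv ℝ T) z a b = fderiv ℝ (fderiv ℝ T) z b a := fun a b =>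
    ((hTd.of_le (m := 2) ENat.LEInfty.out).isSymmSndFDerivAt (by simp)) a b
  have hev : η.inChart w =ᶠ[𝓝 z] fun y => (η.inChart u (T y)).comp (fderiv ℝ T y) := by
    have h1 : ∀ᶠ y in 𝓝 z, (extChartAt J w).symm y ∈ (extChartAt J u).source := by
      refine (mdifferentiableAt_extChartAt_symm hzt).continuousAt.eventually
        ((isOpen_extChartAt_source u).mem_nhds ?_)
      rw [hsz]; exact hw
    have h2 : ∀ᶠ y in 𝓝 z, y ∈ (extChartAt J w).target :=
      (isOpen_extChartAt_target w).mem_nhds hzt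
    filter_upwards [h1, h2] with y hy hy'
    ext X
    exact η.inChart_coordChange hy' hy X
  have hη' : HasFDerivAt (η.inChart u) (fderiv ℝ (η.inChart u) (T z)) (T z) := by
    rw [hTz]; exact hη.hasFDerivAt
  have hD : ∀ a b, fderiv ℝ (η.inChart w) z a b =
      fderiv ℝ (η.inChart u) (extChartAt J u w) (fderiv ℝ T z a) (fderiv ℝ T z b) +
      η.inChart u (extChartAt J u w) (fderiv ℝ (fderiv ℝ T) z a b) := by
    intro a b
    have h3 := (hη'.comp z hT1.hasFDerivAt).clm_comp hT2.hasFDerivAt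
    rw [hev.fderiv_eq, show (fun y => (η.inChart u (T y)).comp (fderiv ℝ T y)) =
      fun y => ((η.inChart u ∘ T) y).comp (fderiv ℝ T y) from rfl, h3.fderiv, ← hTz]
    simp [add_comm]
  have hm : ∀ X : TangentSpace J w, fderiv ℝ T z (mfderiv J 𝓘(ℝ, EN) (extChartAt J w) w X) =
      mfderiv J 𝓘(ℝ, EN) (extChartAt J u) w X := by
    intro X
    have h4 : mfderiv J 𝓘(ℝ, EN) (T ∘ extChartAt J w) w = _ :=
      mfderiv_comp w hT1.mdifferentiableAt
        (mdifferentiableAt_extChartAt_of_mem (mem_extChartAt_source w))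
    have h5 : T ∘ extChartAt J w =ᶠ[𝓝 w] extChartAt J u := by
      filter_upwards [extChartAt_source_mem_nhds (I := J) w] with y hy
      simp only [hT, Function.comp_apply, (extChartAt J w).left_inv hy]
    have h6 := h5.mfderiv_eq (I := J) (I' := 𝓘(ℝ, EN))
    rw [mfderiv_eq_fderiv] at h4
    exact (DFunLike.congr_fun h4 X).symm.trans (DFunLike.congr_fun (show
      (mfderiv J 𝓘(ℝ, EN) (T ∘ extChartAt J w) w : EN →L[ℝ] EN) =
        mfderiv J 𝓘(ℝ, EN) (extChartAt J u) w from h6) X)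
  have key : ∀ a b a' b' : EN, fderiv ℝ T z a = a' → fderiv ℝ T z b = b' →
      fderiv ℝ (η.inChart w) z a b - fderiv ℝ (η.inChart w) z b a =
      fderiv ℝ (η.inChart u) (extChartAt J u w) a' b' -
        fderiv ℝ (η.inChart u) (extChartAt J u w) b' a' := by
    rintro a b _ _ rfl rfl
    rw [hD, hD, hsym]; ring
  exact key _ _ _ _ (hm X) (hm Y)

end Charts

/-! ### Charts of `E ⊕ E` and invertibility of the frame map. -/

section FrameBundle

variable {k : ℕ}
  {M : Type*} [TopologicalSpace M] [ChartedSpace (EuclideanSpace ℝ (Fin (k + 1))) M]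
  {E : M → Type*} [∀ p, AddCommGroup (E p)] [TopologicalSpace (TotalSpace (Fin 2 → ℝ) E)] [∀ p, TopologicalSpace (E p)]
  [FiberBundle (Fin 2 → ℝ) E]

variable (k) in
/-- The model vector space of the total space of `E ⊕ E`. -/
abbrev PairsModelSpace : Type :=
  EuclideanSpace ℝ (Fin (k + 1)) × ((Fin 2 → ℝ) × (Fin 2 → ℝ))

theorem pairs_extChartAt_target (u : Pairs E) (z : PairsModelSpace k) :
    z ∈ (extChartAt (pairsModel k) u).target ↔
      z.1 ∈ (extChartAt (𝓡 (k + 1)) u.proj).target ∧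
        (extChartAt (𝓡 (k + 1)) u.proj).symm z.1 ∈
          (trivializationAt (Fin 2 → ℝ) E u.proj).baseSet := by
  rw [FiberBundle.extChartAt_target]
  simp [FiberBundle.prod_trivializationAt']

theorem pairs_extChartAt_symm (u : Pairs E) (z : PairsModelSpace k) :
    (extChartAt (pairsModel k) u).symm z =
      ⟨(extChartAt (𝓡 (k + 1)) u.proj).symm z.1,
        ((trivializationAt (Fin 2 → ℝ) E u.proj).symm
          ((extChartAt (𝓡 (k + 1)) u.proj).symm z.1) z.2.1,
        (trivializationAt (Fin 2 → ℝ) E u.proj).symm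
          ((extChartAt (𝓡 (k + 1)) u.proj).symm z.1) z.2.2)⟩ := by
  rw [FiberBundle.extChartAt]
  rfl

variable [∀ p, Module ℝ (E p)]

theorem finrank_fibre [VectorBundle ℝ (Fin 2 → ℝ) E] (p : M) : Module.finrank ℝ (E p) = 2 := by
  have e := (trivializationAt (Fin 2 → ℝ) E p).continuousLinearEquivAt ℝ p
    (mem_baseSet_trivializationAt _ _ p)
  rw [e.toLinearEquiv.finrank_eq]; simp

theorem exists_eq_of_mem_frames [VectorBundle ℝ (Fin 2 → ℝ) E] {u : Pairs E} (hu : u ∈ frames E) (v : E u.proj) :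
    ∃ a b : ℝ, v = a • u.snd.1 + b • u.snd.2 := by
  have : FiniteDimensional ℝ (E u.proj) :=
    Module.finite_of_finrank_pos (by rw [finrank_fibre]; norm_num)
  have h1 := hu.span_eq_top_of_card_eq_finrank' (by simp [finrank_fibre])
  have h2 : v ∈ Submodule.span ℝ (Set.range ![u.snd.1, u.snd.2]) := by rw [h1]; trivial
  rw [Matrix.range_cons_cons_empty, Submodule.mem_span_pair] at h2
  obtain ⟨a, b, h⟩ := h2
  exact ⟨a, b, h.symm⟩

variable [IsManifold (𝓡 (k + 1)) ∞ M]

theorem frameMap_apply (σ : GL2Structure k E) (u : Pairs E) (v : V k) :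
    σ.frameMap u v = ∑ i : Fin (k + 1), v i • σ.iso u.proj (symMonomial k i u.snd.1 u.snd.2) := by
  simp [GL2Structure.frameMap, symMonomial]

variable [VectorBundle ℝ (Fin 2 → ℝ) E]

theorem frameMap_isInvertible (σ : GL2Structure k E) {u : Pairs E} (hu : u ∈ frames E) :
    (σ.frameMap u).IsInvertible := by
  have hsurj : Function.Surjective (σ.frameMap u).toLinearMap := by
    rw [← LinearMap.range_eq_top, eq_top_iff]
    have h1 := span_symMonomial k (exists_eq_of_mem_frames hu)
    have h2 := congrArg (Submodule.map (σ.iso u.proj).toLinearMap) h1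
    rw [Submodule.map_top, LinearEquiv.range, Submodule.map_span] at h2
    rw [← h2, Submodule.span_le]
    rintro _ ⟨_, ⟨i, rfl⟩, rfl⟩
    refine ⟨Pi.single i 1, ?_⟩
    rw [ContinuousLinearMap.coe_coe, frameMap_apply, Finset.sum_eq_single i]
    · simp
    · intro j _ hj; simp [hj]
    · simp
  have hfin : Module.finrank ℝ (V k) = Module.finrank ℝ (TangentSpace (𝓡 (k + 1)) u.proj) := by
    change _ = Module.finrank ℝ (EuclideanSpace ℝ (Fin (k + 1)))
    simp
  have : FiniteDimensional ℝ (TangentSpace (𝓡 (k + 1)) u.proj) :=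
    inferInstanceAs (FiniteDimensional ℝ (EuclideanSpace ℝ (Fin (k + 1))))
  have : T2Space (TangentSpace (𝓡 (k + 1)) u.proj) :=
    inferInstanceAs (T2Space (EuclideanSpace ℝ (Fin (k + 1))))
  have hinj := (LinearMap.injective_iff_surjective_of_finrank_eq_finrank hfin).2 hsurj
  exact ⟨(LinearEquiv.ofBijective (σ.frameMap u).toLinearMap ⟨hinj, hsurj⟩).toContinuousLinearEquiv,
    by ext; rfl⟩

variable [ContMDiffVectorBundle ∞ (Fin 2 → ℝ) E (𝓡 (k + 1))]

theorem mfderiv_proj_symm (u : Pairs E) {z : PairsModelSpace k}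
    (hz : z ∈ (extChartAt (pairsModel k) u).target) (X : PairsModelSpace k) :
    (mfderiv (𝓡 (k + 1)) 𝓘(ℝ, EuclideanSpace ℝ (Fin (k + 1)))
      (extChartAt (𝓡 (k + 1)) u.proj) ((extChartAt (pairsModel k) u).symm z).proj)
      (mfderiv (pairsModel k) (𝓡 (k + 1)) (fun w : Pairs E => w.proj)
        ((extChartAt (pairsModel k) u).symm z)
        (mfderiv 𝓘(ℝ, PairsModelSpace k) (pairsModel k) (extChartAt (pairsModel k) u).symm z X)) =
      X.1 := by
  set s := (extChartAt (pairsModel k) u).symm with hs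
  set g : Pairs E → M := fun w => w.proj with hg
  set f := extChartAt (𝓡 (k + 1)) u.proj with hf
  have hsd : MDifferentiableAt 𝓘(ℝ, PairsModelSpace k) (pairsModel k) s z :=
    mdifferentiableAt_extChartAt_symm hz
  have hgd : MDifferentiableAt (pairsModel k) (𝓡 (k + 1)) g (s z) :=
    (contMDiff_proj (E ×ᵇ E)).mdifferentiable (n := ∞) (by simp) (s z)
  have hgs : g (s z) = f.symm z.1 := by
    simp only [hg, hs, pairs_extChartAt_symm]; rfl
  have hz1 := ((pairs_extChartAt_target u z).1 hz).1
  have hfd : MDifferentiableAt (𝓡 (k + 1)) 𝓘(ℝ, EuclideanSpace ℝ (Fin (k + 1))) f (g (s z)) := by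
    apply mdifferentiableAt_extChartAt_of_mem
    rw [hgs]
    exact f.map_target hz1
  have h1 := mfderiv_comp z hgd hsd
  have h2 := mfderiv_comp z hfd (hgd.comp z hsd)
  have hev : f ∘ (g ∘ s) =ᶠ[𝓝 z] Prod.fst := by
    filter_upwards [(isOpen_extChartAt_target (I := pairsModel k) u).mem_nhds hz] with y hy
    have : g (s y) = f.symm y.1 := by
      simp only [hg, hs, pairs_extChartAt_symm]; rfl
    rw [Function.comp_apply, Function.comp_apply, this]
    exact f.right_inv ((pairs_extChartAt_target u y).1 hy).1
  have h3 : (mfderiv 𝓘(ℝ, PairsModelSpace k) 𝓘(ℝ, EuclideanSpace ℝ (Fin (k + 1)))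
      (f ∘ (g ∘ s)) z : PairsModelSpace k →L[ℝ] EuclideanSpace ℝ (Fin (k + 1))) =
      ContinuousLinearMap.fst ℝ (EuclideanSpace ℝ (Fin (k + 1))) ((Fin 2 → ℝ) × (Fin 2 → ℝ)) := by
    rw [mfderiv_eq_fderiv, hev.fderiv_eq]
    exact fderiv_fst
  rw [h1] at h2
  exact (DFunLike.congr_fun h2 X).symm.trans (DFunLike.congr_fun h3 X)

end FrameBundle

/-! ### The induced frame of `TM` in a chart: smoothness and vertical derivative. -/

section FrameChart

variable {k : ℕ}
  {M : Type*} [TopologicalSpace M] [ChartedSpace (EuclideanSpace ℝ (Fin (k + 1))) M]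
  {E : M → Type*} [∀ p, AddCommGroup (E p)] [TopologicalSpace (TotalSpace (Fin 2 → ℝ) E)]
  [∀ p, TopologicalSpace (E p)] [FiberBundle (Fin 2 → ℝ) E] [∀ p, Module ℝ (E p)]

variable [IsManifold (𝓡 (k + 1)) ∞ M]

/-- The frame `(x^k, …, y^k)` expressed in the chart of `M`, over a chart of `E ⊕ E`. -/
def frameChart (σ : GL2Structure k E) (u : Pairs E) (z : PairsModelSpace k) :
    V k →L[ℝ] EuclideanSpace ℝ (Fin (k + 1)) :=
  (mfderiv (𝓡 (k + 1)) 𝓘(ℝ, EuclideanSpace ℝ (Fin (k + 1))) (extChartAt (𝓡 (k + 1)) u.proj)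
    ((extChartAt (pairsModel k) u).symm z).proj).comp
    (σ.frameMap ((extChartAt (pairsModel k) u).symm z))

/-- The soldering form in a chart. -/
def solderChart (σ : GL2Structure k E) (u : Pairs E) (z : PairsModelSpace k) :
    PairsModelSpace k →L[ℝ] V k :=
  ContinuousLinearMap.pi fun i => (σ.solder i).inChart u z

/-- The connection form in a chart. -/
def connChart (φ : GL2Connection k E) (u : Pairs E) (z : PairsModelSpace k) :
    PairsModelSpace k →L[ℝ] (Fin 2 → Fin 2 → ℝ) :=
  ContinuousLinearMap.pi fun i => ContinuousLinearMap.pi fun j => (φ.form i j).inChart u z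

theorem frameChart_apply (σ : GL2Structure k E) (u : Pairs E) (z : PairsModelSpace k) (v : V k) :
    frameChart σ u z v = ∑ i : Fin (k + 1), v i •
      (mfderiv (𝓡 (k + 1)) 𝓘(ℝ, EuclideanSpace ℝ (Fin (k + 1))) (extChartAt (𝓡 (k + 1)) u.proj)
        ((extChartAt (𝓡 (k + 1)) u.proj).symm z.1)
        (σ.iso ((extChartAt (𝓡 (k + 1)) u.proj).symm z.1) (symMonomial k i
          ((trivializationAt (Fin 2 → ℝ) E u.proj).symm
            ((extChartAt (𝓡 (k + 1)) u.proj).symm z.1) z.2.1)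
          ((trivializationAt (Fin 2 → ℝ) E u.proj).symm
            ((extChartAt (𝓡 (k + 1)) u.proj).symm z.1) z.2.2))) :
          EuclideanSpace ℝ (Fin (k + 1))) := by
  rw [frameChart, pairs_extChartAt_symm]
  set p := (extChartAt (𝓡 (k + 1)) u.proj).symm z.1 with hp
  have h1 : ∀ (L : TangentSpace (𝓡 (k + 1)) p →ₗ[ℝ] EuclideanSpace ℝ (Fin (k + 1)))
      (g : Fin (k + 1) → TangentSpace (𝓡 (k + 1)) p),
      L (∑ i, v i • g i) = ∑ i, v i • L (g i) := fun L g => by simp only [map_sum, map_smul]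
  let L : TangentSpace (𝓡 (k + 1)) p →ₗ[ℝ] EuclideanSpace ℝ (Fin (k + 1)) :=
    (mfderiv (𝓡 (k + 1)) 𝓘(ℝ, EuclideanSpace ℝ (Fin (k + 1)))
      (extChartAt (𝓡 (k + 1)) u.proj) p).toLinearMap
  exact (congrArg L (frameMap_apply σ _ v)).trans (h1 L _)

variable [VectorBundle ℝ (Fin 2 → ℝ) E]

omit [IsManifold (𝓡 (k + 1)) ∞ M] in
theorem mem_frames_iff (u : Pairs E) {z : PairsModelSpace k}
    (hz : z ∈ (extChartAt (pairsModel k) u).target) :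
    (extChartAt (pairsModel k) u).symm z ∈ frames E ↔ LinearIndependent ℝ ![z.2.1, z.2.2] := by
  set e := trivializationAt (Fin 2 → ℝ) E u.proj with he
  set p := (extChartAt (𝓡 (k + 1)) u.proj).symm z.1 with hp
  have hb : p ∈ e.baseSet := ((pairs_extChartAt_target u z).1 hz).2
  rw [pairs_extChartAt_symm]
  change LinearIndependent ℝ ![e.symm p z.2.1, e.symm p z.2.2] ↔ _
  have h1 : ![e.symm p z.2.1, e.symm p z.2.2] = e.symmₗ ℝ p ∘ ![z.2.1, z.2.2] := by
    ext i
    fin_cases i <;> simp [e.symmₗ_apply (R := ℝ) hb]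
  rw [h1]
  exact LinearMap.linearIndependent_iff _ (LinearMap.ker_eq_bot.2
    (Function.LeftInverse.injective (e.linearMapAt_symmₗ hb)))

omit [IsManifold (𝓡 (k + 1)) ∞ M] in
theorem eventually_mem_frames (u : Pairs E) {z : PairsModelSpace k}
    (hz : z ∈ (extChartAt (pairsModel k) u).target)
    (hzf : (extChartAt (pairsModel k) u).symm z ∈ frames E) :
    ∀ᶠ y in 𝓝 z, y ∈ (extChartAt (pairsModel k) u).target ∧
      (extChartAt (pairsModel k) u).symm y ∈ frames E := by
  have h1 : ∀ᶠ y in 𝓝 z, y ∈ (extChartAt (pairsModel k) u).target :=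
    (isOpen_extChartAt_target u).mem_nhds hz
  have hc : Continuous fun y : PairsModelSpace k => ![y.2.1, y.2.2] := by fun_prop
  have h2 : ∀ᶠ y in 𝓝 z, LinearIndependent ℝ ![y.2.1, y.2.2] :=
    hc.continuousAt.eventually (isOpen_setOfPred_linearIndependent.mem_nhds
      ((mem_frames_iff u hz).1 hzf))
  filter_upwards [h1, h2] with y hy hy'
  exact ⟨hy, (mem_frames_iff u hy).2 hy'⟩

theorem frameChart_isInvertible (σ : GL2Structure k E) (u : Pairs E) {z : PairsModelSpace k}
    (hz : z ∈ (extChartAt (pairsModel k) u).target)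
    (hzf : (extChartAt (pairsModel k) u).symm z ∈ frames E) :
    (frameChart σ u z).IsInvertible := by
  have : IsManifold (𝓡 (k + 1)) 1 M := IsManifold.of_le (n := ∞) (by simp)
  have h1 : ((extChartAt (pairsModel k) u).symm z).proj ∈
      (extChartAt (𝓡 (k + 1)) u.proj).source := by
    rw [pairs_extChartAt_symm]
    exact PartialEquiv.map_target _ ((pairs_extChartAt_target u z).1 hz).1
  exact (isInvertible_mfderiv_extChartAt h1).comp (frameMap_isInvertible σ hzf)

/-- Trivializations are linear on fibres, so this line in the chart is the curve `(x, y)(1 + tA)`,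
and the derivative is that of the monomials in the symmetric power. -/
theorem hasDerivAt_frameChart (σ : GL2Structure k E) (u : Pairs E) {z : PairsModelSpace k}
    (hz : z ∈ (extChartAt (pairsModel k) u).target) (A : Matrix (Fin 2) (Fin 2) ℝ) (v : V k) :
    HasDerivAt (fun t : ℝ => frameChart σ u (z + t • ((0, (A 0 0 • z.2.1 + A 1 0 • z.2.2,
      A 0 1 • z.2.1 + A 1 1 • z.2.2)) : PairsModelSpace k)) v)
      (frameChart σ u z ((rep k A).mulVec v)) 0 := by
  set e := trivializationAt (Fin 2 → ℝ) E u.proj with he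
  set p := (extChartAt (𝓡 (k + 1)) u.proj).symm z.1 with hp
  have hb : p ∈ e.baseSet := ((pairs_extChartAt_target u z).1 hz).2
  let L : Sym[ℝ]^k (E p) →ₗ[ℝ] EuclideanSpace ℝ (Fin (k + 1)) :=
    (mfderiv (𝓡 (k + 1)) 𝓘(ℝ, EuclideanSpace ℝ (Fin (k + 1)))
      (extChartAt (𝓡 (k + 1)) u.proj) p).toLinearMap ∘ₗ (σ.iso p).toLinearMap
  have hL : ∀ (h : (Fin 2 → ℝ) × (Fin 2 → ℝ)) (v : V k), frameChart σ u (z.1, h) v =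
      ∑ i : Fin (k + 1), v i • L (symMonomial k i (e.symm p h.1) (e.symm p h.2)) :=
    fun h v => frameChart_apply σ u (z.1, h) v
  have hs : ∀ (a b : Fin 2 → ℝ) (c d t : ℝ) (w : Fin 2 → ℝ), e.symm p (w + t • (c • a + d • b)) =
      e.symm p w + t • (c • e.symm p a + d • e.symm p b) := fun a b c d t w => by
    simp only [← e.symmₗ_apply (R := ℝ) hb, map_add, map_smul]
  have h1 : HasDerivAt (fun t : ℝ => ∑ i : Fin (k + 1), v i • L (symMonomial k i
      (e.symm p z.2.1 + t • (A 0 0 • e.symm p z.2.1 + A 1 0 • e.symm p z.2.2))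
      (e.symm p z.2.2 + t • (A 0 1 • e.symm p z.2.1 + A 1 1 • e.symm p z.2.2))))
      (∑ i : Fin (k + 1), v i • ∑ r : Fin (k + 1), rep k A r i •
        L (symMonomial k r (e.symm p z.2.1) (e.symm p z.2.2))) 0 :=
    HasDerivAt.fun_sum fun i _ => (hasDerivAt_symMonomial k L _ _ A i).const_smul (v i)
  convert h1 using 1
  · ext1 t
    rw [show z + t • ((0, (A 0 0 • z.2.1 + A 1 0 • z.2.2,
      A 0 1 • z.2.1 + A 1 1 • z.2.2)) : PairsModelSpace k) = (z.1, (z.2.1 +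
        t • (A 0 0 • z.2.1 + A 1 0 • z.2.2), z.2.2 + t • (A 0 1 • z.2.1 + A 1 1 • z.2.2))) by
      ext1 <;> simp; rfl, hL]
    simp only [hs]
  · rw [show z = (z.1, z.2) from rfl, hL]
    simp only [Matrix.mulVec, dotProduct, Finset.sum_smul, Finset.smul_sum, smul_smul]
    rw [Finset.sum_comm]
    simp only [mul_comm]

theorem mfderiv_extChartAt_eq_trivializationAt {p₀ p : M}
    (hp : p ∈ (chartAt (EuclideanSpace ℝ (Fin (k + 1))) p₀).source)
    (v : TangentSpace (𝓡 (k + 1)) p) :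
    (mfderiv (𝓡 (k + 1)) 𝓘(ℝ, EuclideanSpace ℝ (Fin (k + 1))) (extChartAt (𝓡 (k + 1)) p₀) p v :
      EuclideanSpace ℝ (Fin (k + 1))) =
      (trivializationAt (EuclideanSpace ℝ (Fin (k + 1))) (TangentSpace (𝓡 (k + 1))) p₀
        (⟨p, v⟩ : TangentBundle (𝓡 (k + 1)) M)).2 := by
  have : IsManifold (𝓡 (k + 1)) 1 M := IsManifold.of_le (n := ∞) (by simp)
  refine (DFunLike.congr_fun (TangentBundle.continuousLinearMapAt_trivializationAt hp) v).symm.trans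
    ?_
  rw [Trivialization.continuousLinearMapAt_apply, Trivialization.coe_linearMapAt_of_mem _ (by
      rw [TangentBundle.trivializationAt_baseSet]; exact hp)]

/-- Smooth local sections of `TM` given by the isomorphism have smooth coefficients. -/
theorem contDiffAt_iso_tprod [ContMDiffVectorBundle ∞ (Fin 2 → ℝ) E (𝓡 (k + 1))]
    (σ : GL2Structure k E) (p₀ : M) (c : Fin k → Fin 2 → ℝ) :
    ContDiffAt ℝ ∞ (fun q : EuclideanSpace ℝ (Fin (k + 1)) =>
      (mfderiv (𝓡 (k + 1)) 𝓘(ℝ, EuclideanSpace ℝ (Fin (k + 1))) (extChartAt (𝓡 (k + 1)) p₀)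
        ((extChartAt (𝓡 (k + 1)) p₀).symm q)
        (σ.iso ((extChartAt (𝓡 (k + 1)) p₀).symm q) (SymmetricPower.tprod ℝ fun m =>
          (trivializationAt (Fin 2 → ℝ) E p₀).symm ((extChartAt (𝓡 (k + 1)) p₀).symm q) (c m))) :
          EuclideanSpace ℝ (Fin (k + 1)))) (extChartAt (𝓡 (k + 1)) p₀ p₀) := by
  have : IsManifold (𝓡 (k + 1)) 1 M := IsManifold.of_le (n := ∞) (by simp)
  set e := trivializationAt (Fin 2 → ℝ) E p₀ with he
  have hp₀ : p₀ ∈ e.baseSet := mem_baseSet_trivializationAt _ _ _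
  have hsec : ∀ c : Fin 2 → ℝ, ContMDiffOn (𝓡 (k + 1)) ((𝓡 (k + 1)).prod 𝓘(ℝ, Fin 2 → ℝ)) ∞
      (fun p => (⟨p, e.symm p c⟩ : TotalSpace (Fin 2 → ℝ) E)) e.baseSet := fun c => by
    have h1 := (e.contMDiffOn_symm (IB := 𝓡 (k + 1)) (n := ∞)).comp
      (s := e.baseSet) (f := fun p => (p, c))
      (contMDiff_id.prodMk contMDiff_const).contMDiffOn (fun p hp => by
        simpa [e.mem_target] using hp)
    exact h1.congr fun p hp => e.mk_symm hp c
  have h2 := (σ.smooth e.baseSet (fun m p => e.symm p (c m)) e.open_baseSet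
    fun m => hsec (c m)).contMDiffAt (e.open_baseSet.mem_nhds hp₀)
  have h3 := (contMDiffAt_section p₀).1 h2
  have h4 : ContMDiffAt 𝓘(ℝ, EuclideanSpace ℝ (Fin (k + 1))) (𝓡 (k + 1)) ∞
      (extChartAt (𝓡 (k + 1)) p₀).symm (extChartAt (𝓡 (k + 1)) p₀ p₀) :=
    (contMDiffOn_extChartAt_symm p₀).contMDiffAt (extChartAt_target_mem_nhds p₀)
  have h5 := ContMDiffAt.comp_of_eq h3 h4 (extChartAt_to_inv p₀)
  refine h5.contDiffAt.congr_of_eventuallyEq ?_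
  filter_upwards [extChartAt_target_mem_nhds (I := 𝓡 (k + 1)) p₀] with q hq
  have hq' : (extChartAt (𝓡 (k + 1)) p₀).symm q ∈
      (chartAt (EuclideanSpace ℝ (Fin (k + 1))) p₀).source := by
    rw [← extChartAt_source (I := 𝓡 (k + 1))]
    exact PartialEquiv.map_target _ hq
  exact mfderiv_extChartAt_eq_trivializationAt hq' _

/-- Expanding `x` and `y` in the frame of `E` given by the trivialization, the monomials become
polynomials in the fibre coordinates, with coefficients that depend smoothly on the base point by
`contDiffAt_iso_tprod`. -/
theorem contDiffAt_frameChart [ContMDiffVectorBundle ∞ (Fin 2 → ℝ) E (𝓡 (k + 1))]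
    (σ : GL2Structure k E) (u : Pairs E) :
    ContDiffAt ℝ ∞ (frameChart σ u) (extChartAt (pairsModel k) u u) := by
  set e := trivializationAt (Fin 2 → ℝ) E u.proj with he
  set z₀ := extChartAt (pairsModel k) u u with hz₀
  have hz₀t : z₀ ∈ (extChartAt (pairsModel k) u).target := mem_extChartAt_target u
  have hz₀1 : z₀.1 = extChartAt (𝓡 (k + 1)) u.proj u.proj := by
    have h1 : (extChartAt (pairsModel k) u).symm z₀ = u := extChartAt_to_inv u
    rw [pairs_extChartAt_symm] at h1
    have h2 : (extChartAt (𝓡 (k + 1)) u.proj).symm z₀.1 = u.proj := congrArg TotalSpace.proj h1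
    have h3 := PartialEquiv.right_inv _ ((pairs_extChartAt_target u z₀).1 hz₀t).1
    rw [h2] at h3
    exact h3.symm
  let b : Fin 2 → Fin 2 → ℝ := fun j => Pi.single j 1
  let D : (Fin k → Fin 2) → PairsModelSpace k → EuclideanSpace ℝ (Fin (k + 1)) := fun r z =>
    mfderiv (𝓡 (k + 1)) 𝓘(ℝ, EuclideanSpace ℝ (Fin (k + 1))) (extChartAt (𝓡 (k + 1)) u.proj)
      ((extChartAt (𝓡 (k + 1)) u.proj).symm z.1)
      (σ.iso ((extChartAt (𝓡 (k + 1)) u.proj).symm z.1) (SymmetricPower.tprod ℝ fun m =>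
        e.symm ((extChartAt (𝓡 (k + 1)) u.proj).symm z.1) (b (r m))))
  have hD : ∀ r, ContDiffAt ℝ ∞ (D r) z₀ := fun r => by
    have h1 := contDiffAt_iso_tprod σ u.proj (fun m => b (r m))
    rw [← hz₀1] at h1
    exact h1.comp z₀ contDiffAt_fst
  have hmain : frameChart σ u =ᶠ[𝓝 z₀] fun z => ∑ i : Fin (k + 1),
      (ContinuousLinearMap.proj (R := ℝ) (φ := fun _ : Fin (k + 1) => ℝ) i).smulRight
        (∑ r : Fin k → Fin 2, (∏ m : Fin k, if (m : ℕ) < k - i then z.2.1 (r m) else z.2.2 (r m)) •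
          D r z) := by
    filter_upwards [(isOpen_extChartAt_target (I := pairsModel k) u).mem_nhds hz₀t] with z hz
    have hb : (extChartAt (𝓡 (k + 1)) u.proj).symm z.1 ∈ e.baseSet :=
      ((pairs_extChartAt_target u z).1 hz).2
    set p := (extChartAt (𝓡 (k + 1)) u.proj).symm z.1 with hp
    have hs : ∀ h : Fin 2 → ℝ, e.symm p h = h 0 • e.symm p (b 0) + h 1 • e.symm p (b 1) :=
      fun h => by
        simp only [← e.symmₗ_apply (R := ℝ) hb, ← map_smul, ← map_add]
        congr 1
        ext j; fin_cases j <;> simp [b]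
    refine ContinuousLinearMap.ext fun v => ?_
    rw [frameChart_apply]
    simp only [sum_apply, ContinuousLinearMap.smulRight_apply,
      ContinuousLinearMap.proj_apply]
    refine Finset.sum_congr rfl fun i _ => ?_
    congr 1
    have h2 : symMonomial k i (e.symm p z.2.1) (e.symm p z.2.2) = ∑ r : Fin k → Fin 2,
        (∏ m : Fin k, if (m : ℕ) < k - i then z.2.1 (r m) else z.2.2 (r m)) •
          SymmetricPower.tprod ℝ fun m => e.symm p (b (r m)) := by
      have h3 := tprod_add_eq_sum k (e.symm p (b 0)) (e.symm p (b 1))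
        (fun m j => if (m : ℕ) < k - i then z.2.1 j else z.2.2 j)
      have h4 : ∀ r : Fin k → Fin 2, (fun m => if r m = 0 then e.symm p (b 0) else
          e.symm p (b 1)) = fun m => e.symm p (b (r m)) := fun r => by
        ext m
        rcases Fin.exists_fin_two.1 ⟨r m, rfl⟩ with h | h <;> simp [h]
      simp only [h4] at h3
      rw [← h3, symMonomial]
      congr 1
      ext m
      split_ifs
      · exact hs _
      · exact hs _
    let L : Sym[ℝ]^k (E p) →ₗ[ℝ] EuclideanSpace ℝ (Fin (k + 1)) :=
      (mfderiv (𝓡 (k + 1)) 𝓘(ℝ, EuclideanSpace ℝ (Fin (k + 1)))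
        (extChartAt (𝓡 (k + 1)) u.proj) p).toLinearMap ∘ₗ (σ.iso p).toLinearMap
    change L _ = ∑ r : Fin k → Fin 2, _ • L (SymmetricPower.tprod ℝ fun m => e.symm p (b (r m)))
    rw [h2, map_sum]
    simp only [map_smul]
  refine ContDiffAt.congr_of_eventuallyEq ?_ hmain
  refine ContDiffAt.sum fun i _ => contDiffAt_const.smulRight (ContDiffAt.sum fun r _ => ?_)
  refine ContDiffAt.fun_smul (contDiffAt_prod fun m _ => ?_) (hD r)
  split_ifs <;> fun_prop

end FrameChart

/-- The representation `rep` as a continuous bilinear map. -/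
def repL (k : ℕ) : (Fin 2 → Fin 2 → ℝ) →L[ℝ] V k →L[ℝ] V k :=
  LinearMap.toContinuousLinearMap (LinearMap.toContinuousLinearMap.toLinearMap ∘ₗ
    (LinearMap.mk₂ ℝ (fun (A : Fin 2 → Fin 2 → ℝ) (v : V k) => (rep k (Matrix.of A)).mulVec v)
      (fun A B v => by
        rw [← Matrix.add_mulVec]; congr 1; ext i j
        simp only [rep, Matrix.of_apply, Matrix.add_apply, Pi.add_apply]; split_ifs <;> ring)
      (fun c A v => by
        rw [← Matrix.smul_mulVec]; congr 1; ext i j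
        simp only [rep, Matrix.of_apply, Matrix.smul_apply, Pi.smul_apply, smul_eq_mul]
        split_ifs <;> ring)
      (fun A v w => Matrix.mulVec_add _ _ _)
      (fun c A v => Matrix.mulVec_smul _ _ _)))

theorem repL_apply (k : ℕ) (A : Fin 2 → Fin 2 → ℝ) (v : V k) :
    repL k A v = (rep k (Matrix.of A)).mulVec v := rfl

/-! ### The soldering and connection forms in a chart. -/

section FormsInChart

variable {k : ℕ}
  {M : Type*} [TopologicalSpace M] [ChartedSpace (EuclideanSpace ℝ (Fin (k + 1))) M]
  [IsManifold (𝓡 (k + 1)) ∞ M]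
  {E : M → Type*} [∀ p, AddCommGroup (E p)] [∀ p, Module ℝ (E p)]
  [TopologicalSpace (TotalSpace (Fin 2 → ℝ) E)] [∀ p, TopologicalSpace (E p)]
  [FiberBundle (Fin 2 → ℝ) E] [VectorBundle ℝ (Fin 2 → ℝ) E]
  [ContMDiffVectorBundle ∞ (Fin 2 → ℝ) E (𝓡 (k + 1))]

theorem frameChart_solderChart (σ : GL2Structure k E) (u : Pairs E) {z : PairsModelSpace k}
    (hz : z ∈ (extChartAt (pairsModel k) u).target)
    (hzf : (extChartAt (pairsModel k) u).symm z ∈ frames E) (X : PairsModelSpace k) :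
    frameChart σ u z (solderChart σ u z X) = X.1 := by
  refine Eq.trans ?_ (mfderiv_proj_symm u hz X)
  exact congrArg (mfderiv (𝓡 (k + 1)) 𝓘(ℝ, EuclideanSpace ℝ (Fin (k + 1)))
      (extChartAt (𝓡 (k + 1)) u.proj) ((extChartAt (pairsModel k) u).symm z).proj)
    ((frameMap_isInvertible σ hzf).self_apply_inverse _)

/-- Reduces smoothness of the soldering form to smoothness of the frame and of operator inversion.
-/
theorem solderChart_eq (σ : GL2Structure k E) (u : Pairs E) {z : PairsModelSpace k}
    (hz : z ∈ (extChartAt (pairsModel k) u).target)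
    (hzf : (extChartAt (pairsModel k) u).symm z ∈ frames E) :
    solderChart σ u z = (frameChart σ u z).inverse.comp (ContinuousLinearMap.fst ℝ _ _) := by
  refine ContinuousLinearMap.ext fun X => ?_
  apply (frameChart_isInvertible σ u hz hzf).injective
  rw [frameChart_solderChart σ u hz hzf, ContinuousLinearMap.comp_apply,
    (frameChart_isInvertible σ u hz hzf).self_apply_inverse]
  rfl

theorem contDiffAt_solderChart (σ : GL2Structure k E) {u : Pairs E} (hu : u ∈ frames E) :
    ContDiffAt ℝ ∞ (solderChart σ u) (extChartAt (pairsModel k) u u) := by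
  have hz := mem_extChartAt_target (I := pairsModel k) u
  have hzf : (extChartAt (pairsModel k) u).symm (extChartAt (pairsModel k) u u) ∈ frames E := by
    rwa [extChartAt_to_inv]
  have h1 := ((frameChart_isInvertible σ u hz hzf).contDiffAt_map_inverse (n := ∞)).comp _
    (contDiffAt_frameChart σ u)
  refine (h1.clm_comp (g := fun x => (frameChart σ u x).inverse)
    (contDiffAt_const (c := ContinuousLinearMap.fst ℝ (EuclideanSpace ℝ (Fin (k + 1)))
      ((Fin 2 → ℝ) × (Fin 2 → ℝ))))).congr_of_eventuallyEq ?_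
  filter_upwards [eventually_mem_frames u hz hzf] with y hy
  exact solderChart_eq σ u hy.1 hy.2

omit [IsManifold (𝓡 (k + 1)) ∞ M] [VectorBundle ℝ (Fin 2 → ℝ) E]
  [ContMDiffVectorBundle ∞ (Fin 2 → ℝ) E (𝓡 (k + 1))] in
theorem contDiffAt_connChart (φ : GL2Connection k E) {u : Pairs E} (hu : u ∈ frames E) :
    ContDiffAt ℝ ∞ (connChart φ u) (extChartAt (pairsModel k) u u) := by
  have h : connChart φ u = fun z => ∑ i, ∑ j, ((φ.form i j).inChart u z).smulRight
      (Pi.single i (Pi.single j 1) : Fin 2 → Fin 2 → ℝ) := by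
    refine funext fun z => ContinuousLinearMap.ext fun X => ?_
    ext i j
    fin_cases i <;> fin_cases j <;> simp [connChart]
  rw [h]
  exact ContDiffAt.sum fun i _ => ContDiffAt.sum fun j _ =>
    ContDiffAt.smulRight (φ.smooth i j u hu) contDiffAt_const

/-- The value at `z` of the vector field generated by `A`. -/
def vertical (z : PairsModelSpace k) (A : Matrix (Fin 2) (Fin 2) ℝ) : PairsModelSpace k :=
  (0, (A 0 0 • z.2.1 + A 1 0 • z.2.2, A 0 1 • z.2.1 + A 1 1 • z.2.2))

-- The curve `(x, y)(1 + tA)` is affine in `t` in the fibre coordinates, hence an exact straight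
-- line in the chart.
omit [IsManifold (𝓡 (k + 1)) ∞ M] [ContMDiffVectorBundle ∞ (Fin 2 → ℝ) E (𝓡 (k + 1))] in
theorem act_symm (u : Pairs E) {z : PairsModelSpace k}
    (hz : z ∈ (extChartAt (pairsModel k) u).target) (A : Matrix (Fin 2) (Fin 2) ℝ) (t : ℝ) :
    act ((extChartAt (pairsModel k) u).symm z) (1 + t • A) =
      (extChartAt (pairsModel k) u).symm (z + t • vertical z A) := by
  have hb := ((pairs_extChartAt_target u z).1 hz).2
  rw [pairs_extChartAt_symm, pairs_extChartAt_symm]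
  have h1 : (z + t • vertical z A).1 = z.1 := by simp [vertical]
  rw [h1]
  simp only [act]
  congr 1
  simp only [← Trivialization.symmₗ_apply (R := ℝ) _ hb, ← map_smul, ← map_add]
  congr 2
  all_goals
  · simp [vertical]
    module

theorem connChart_vertical (φ : GL2Connection k E) (u : Pairs E) {z : PairsModelSpace k}
    (hz : z ∈ (extChartAt (pairsModel k) u).target)
    (hzf : (extChartAt (pairsModel k) u).symm z ∈ frames E) (A : Matrix (Fin 2) (Fin 2) ℝ) :
    Matrix.of (connChart φ u z (vertical z A)) = A := by
  ext i j
  have h1 := φ.fundamental _ hzf A i j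
  have hc : (fun t : ℝ => act ((extChartAt (pairsModel k) u).symm z) (1 + t • A)) =
      (extChartAt (pairsModel k) u).symm ∘ fun t : ℝ => z + t • vertical z A :=
    funext fun t => act_symm u hz A t
  have hl : HasFDerivAt (fun t : ℝ => z + t • vertical z A)
      ((ContinuousLinearMap.id ℝ ℝ).smulRight (vertical z A)) 0 :=
    ((hasFDerivAt_id (0 : ℝ)).smul_const (vertical z A)).const_add z
  have h2 : (mfderiv 𝓘(ℝ, ℝ) (pairsModel k) (fun t : ℝ =>
      act ((extChartAt (pairsModel k) u).symm z) (1 + t • A)) 0 : ℝ →L[ℝ] PairsModelSpace k) 1 =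
      (mfderiv 𝓘(ℝ, PairsModelSpace k) (pairsModel k) (extChartAt (pairsModel k) u).symm z :
        PairsModelSpace k →L[ℝ] PairsModelSpace k) (vertical z A) := by
    rw [hc]
    have h3 := mfderiv_comp_apply_of_eq (I := 𝓘(ℝ, ℝ)) (I' := 𝓘(ℝ, PairsModelSpace k))
      (I'' := pairsModel k) (x := (0 : ℝ)) (y := z) (f := fun t : ℝ => z + t • vertical z A)
      (mdifferentiableAt_extChartAt_symm hz) hl.differentiableAt.mdifferentiableAt (by simp)
      (1 : ℝ)
    rw [mfderiv_eq_fderiv, hl.fderiv] at h3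
    have h5 : ((ContinuousLinearMap.id ℝ ℝ).smulRight (vertical z A)) 1 = vertical z A := by simp
    exact h3.trans (congrArg (mfderiv 𝓘(ℝ, PairsModelSpace k) (pairsModel k)
      (extChartAt (pairsModel k) u).symm z : PairsModelSpace k →L[ℝ] PairsModelSpace k) h5)
  have h4 : act ((extChartAt (pairsModel k) u).symm z) (1 + (0 : ℝ) • A) =
      (extChartAt (pairsModel k) u).symm z := by
    rw [act_symm u hz]; simp
  refine Eq.trans ?_ h1
  refine Eq.trans ?_ (congrArg (φ.form i j (act ((extChartAt (pairsModel k) u).symm z)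
    (1 + (0 : ℝ) • A))) h2).symm
  exact oneForm_apply_congr (φ.form i j) h4.symm _

end FormsInChart

/-! ### Horizontality of the torsion and horizontal lifts. -/

section Lift

variable {k : ℕ}
  {M : Type*} [TopologicalSpace M] [ChartedSpace (EuclideanSpace ℝ (Fin (k + 1))) M]
  [IsManifold (𝓡 (k + 1)) ∞ M]
  {E : M → Type*} [∀ p, AddCommGroup (E p)] [∀ p, Module ℝ (E p)]
  [TopologicalSpace (TotalSpace (Fin 2 → ℝ) E)] [∀ p, TopologicalSpace (E p)]
  [FiberBundle (Fin 2 → ℝ) E] [VectorBundle ℝ (Fin 2 → ℝ) E]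
  [ContMDiffVectorBundle ∞ (Fin 2 → ℝ) E (𝓡 (k + 1))]

theorem solderChart_eq_zero (σ : GL2Structure k E) (u : Pairs E) {z : PairsModelSpace k}
    (hz : z ∈ (extChartAt (pairsModel k) u).target)
    (hzf : (extChartAt (pairsModel k) u).symm z ∈ frames E) {X : PairsModelSpace k} :
    solderChart σ u z X = 0 ↔ X.1 = 0 := by
  rw [← frameChart_solderChart σ u hz hzf X]
  exact (map_eq_zero_iff _ (frameChart_isInvertible σ u hz hzf).injective).symm

/-- The contraction of the torsion with a vertical vector vanishes. -/
theorem flatTorsion_vertical (σ : GL2Structure k E) (φ : GL2Connection k E) (u : Pairs E)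
    {z : PairsModelSpace k} (hz : z ∈ (extChartAt (pairsModel k) u).target)
    (hzf : (extChartAt (pairsModel k) u).symm z ∈ frames E)
    (hF : DifferentiableAt ℝ (frameChart σ u) z) (hS : DifferentiableAt ℝ (solderChart σ u) z)
    (A : Matrix (Fin 2) (Fin 2) ℝ) (Y : PairsModelSpace k) :
    flatTorsion (repL k) (solderChart σ u) (connChart φ u) z (vertical z A) Y = 0 := by
  have hev := eventually_mem_frames u hz hzf
  have hX : ∀ y : PairsModelSpace k, y ∈ (extChartAt (pairsModel k) u).target →
      (extChartAt (pairsModel k) u).symm y ∈ frames E → solderChart σ u y (vertical z A) = 0 :=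
    fun y hy hyf => (solderChart_eq_zero σ u hy hyf).2 rfl
  have hline : HasDerivAt (fun t : ℝ => z + t • vertical z A) (vertical z A) 0 := by
    simpa using ((hasDerivAt_id (0 : ℝ)).smul_const (vertical z A)).const_add z
  have h0 : z + (0 : ℝ) • vertical z A = z := by simp
  have hF1 : HasDerivAt (fun t : ℝ => frameChart σ u (z + t • vertical z A))
      (fderiv ℝ (frameChart σ u) z (vertical z A)) 0 :=
    HasFDerivAt.comp_hasDerivAt_of_eq (0 : ℝ) hF.hasFDerivAt hline h0.symm
  have hS1 : HasDerivAt (fun t : ℝ => solderChart σ u (z + t • vertical z A))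
      (fderiv ℝ (solderChart σ u) z (vertical z A)) 0 :=
    HasFDerivAt.comp_hasDerivAt_of_eq (0 : ℝ) hS.hasFDerivAt hline h0.symm
  have hS2 := hS1.clm_apply (hasDerivAt_const (0 : ℝ) Y)
  have hFv : ∀ v, fderiv ℝ (frameChart σ u) z (vertical z A) v =
      frameChart σ u z ((rep k A).mulVec v) := fun v => by
    have h1 := hF1.clm_apply (hasDerivAt_const (0 : ℝ) v)
    have h2 := h1.unique (hasDerivAt_frameChart σ u hz A v)
    simpa using h2
  -- Frame and coframe are inverse to each other, so the derivative of this constant along the orbit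
  -- shows that the coframe changes by `-rep k A`, exactly compensating the connection term.
  have hconst : (fun t : ℝ => frameChart σ u (z + t • vertical z A)
      (solderChart σ u (z + t • vertical z A) Y)) =ᶠ[𝓝 0] fun _ => Y.1 := by
    have h1 : Tendsto (fun t : ℝ => z + t • vertical z A) (𝓝 0) (𝓝 z) := by
      have := hline.continuousAt.tendsto
      rwa [h0] at this
    filter_upwards [h1.eventually hev] with t ht
    exact frameChart_solderChart σ u ht.1 ht.2 Y
  have hD1 : (rep k A).mulVec (solderChart σ u z Y) +
      fderiv ℝ (solderChart σ u) z (vertical z A) Y = 0 := by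
    have h1 := (hF1.clm_apply hS2).unique
      ((hasDerivAt_const (0 : ℝ) Y.1).congr_of_eventuallyEq hconst)
    apply (frameChart_isInvertible σ u hz hzf).injective
    rw [map_add, map_zero, ← hFv]
    simpa using h1
  -- The vector `vertical z A` is kept constant in the chart; it stays vertical at nearby points, so
  -- the soldering form vanishes on it there.
  have hD2 : fderiv ℝ (solderChart σ u) z Y (vertical z A) = 0 := by
    have h1 : (fun y => solderChart σ u y (vertical z A)) =ᶠ[𝓝 z] fun _ => 0 := by
      filter_upwards [hev] with y hy using hX y hy.1 hy.2
    have h2 := (hS.hasFDerivAt.clm_apply (hasFDerivAt_const (vertical z A) z)).unique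
      ((hasFDerivAt_const (0 : V k) z).congr_of_eventuallyEq h1)
    simpa using DFunLike.congr_fun h2 Y
  rw [flatTorsion, hD2, hX z hz hzf, map_zero, repL_apply, connChart_vertical φ u hz hzf,
    sub_zero, sub_zero, add_comm]
  exact hD1

omit [IsManifold (𝓡 (k + 1)) ∞ M] [ContMDiffVectorBundle ∞ (Fin 2 → ℝ) E (𝓡 (k + 1))] in
theorem exists_vertical_eq (u : Pairs E) {z : PairsModelSpace k}
    (hz : z ∈ (extChartAt (pairsModel k) u).target)
    (hzf : (extChartAt (pairsModel k) u).symm z ∈ frames E) {X : PairsModelSpace k}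
    (hX : X.1 = 0) : ∃ A, X = vertical z A := by
  have hli := (mem_frames_iff u hz).1 hzf
  have hsp := hli.span_eq_top_of_card_eq_finrank (by simp)
  rw [Matrix.range_cons_cons_empty] at hsp
  have hmem : ∀ w : Fin 2 → ℝ, ∃ a b : ℝ, a • z.2.1 + b • z.2.2 = w := fun w =>
    Submodule.mem_span_pair.1 (hsp ▸ Submodule.mem_top)
  obtain ⟨a, b, h1⟩ := hmem X.2.1
  obtain ⟨c, d, h2⟩ := hmem X.2.2
  exact ⟨!![a, c; b, d], Prod.ext hX (Prod.ext (by simpa [vertical] using h1.symm)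
    (by simpa [vertical] using h2.symm))⟩

/-- The soldering form and the connection form together are injective. -/
theorem eq_of_solderChart_connChart (σ : GL2Structure k E) (φ : GL2Connection k E) (u : Pairs E)
    {z : PairsModelSpace k} (hz : z ∈ (extChartAt (pairsModel k) u).target)
    (hzf : (extChartAt (pairsModel k) u).symm z ∈ frames E) {X Y : PairsModelSpace k}
    (h1 : solderChart σ u z X = solderChart σ u z Y) (h2 : connChart φ u z X = connChart φ u z Y) :
    X = Y := by
  obtain ⟨A, hA⟩ := exists_vertical_eq u hz hzf
    ((solderChart_eq_zero σ u hz hzf (X := X - Y)).1 (by rw [map_sub, h1, sub_self]))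
  have h3 := connChart_vertical φ u hz hzf A
  rw [← hA, map_sub, h2, sub_self] at h3
  have h4 : A = 0 := h3.symm
  rw [← sub_eq_zero, hA, h4]
  simp [vertical]

/-- The soldering and connection forms together are bijective: any lift of `v` can be corrected by a
vertical vector, on which the connection form takes any prescribed value. -/
theorem exists_horizontal (σ : GL2Structure k E) (φ : GL2Connection k E) (u : Pairs E)
    {z : PairsModelSpace k} (hz : z ∈ (extChartAt (pairsModel k) u).target)
    (hzf : (extChartAt (pairsModel k) u).symm z ∈ frames E) :
    ∃ ι : V k →L[ℝ] PairsModelSpace k, (solderChart σ u z).comp ι = .id ℝ (V k) ∧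
      (connChart φ u z).comp ι = 0 := by
  set L := ((solderChart σ u z).prod (connChart φ u z)).toLinearMap with hL
  have hinj : Function.Injective L := fun X Y h =>
    eq_of_solderChart_connChart σ φ u hz hzf (Prod.ext_iff.1 h).1 (Prod.ext_iff.1 h).2
  have hsurj : Function.Surjective L := by
    rintro ⟨v, B⟩
    set X : PairsModelSpace k := (frameChart σ u z v, 0) with hX
    have h1 : solderChart σ u z X = v := by
      apply (frameChart_isInvertible σ u hz hzf).injective
      rw [frameChart_solderChart σ u hz hzf]
    have h2 : connChart φ u z (vertical z (Matrix.of (B - connChart φ u z X))) =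
        B - connChart φ u z X := connChart_vertical φ u hz hzf _
    have h3 : solderChart σ u z (vertical z (Matrix.of (B - connChart φ u z X))) = 0 :=
      (solderChart_eq_zero σ u hz hzf).2 rfl
    refine ⟨X + vertical z (Matrix.of (B - connChart φ u z X)), Prod.ext ?_ ?_⟩
    · change solderChart σ u z _ = v
      rw [map_add, h1, h3, add_zero]
    · change connChart φ u z _ = B
      rw [map_add, h2, add_sub_cancel]
  let e := LinearEquiv.ofBijective L ⟨hinj, hsurj⟩
  have he : ∀ v, L (e.symm (v, 0)) = (v, 0) := fun v => e.apply_symm_apply (v, 0)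
  exact ⟨LinearMap.toContinuousLinearMap (e.symm.toLinearMap ∘ₗ LinearMap.inl ℝ _ _),
    ContinuousLinearMap.ext fun v => congrArg Prod.fst (he v),
    ContinuousLinearMap.ext fun v => congrArg Prod.snd (he v)⟩

/-- `Function.invFun` returns the intended lift because the pair of forms is injective at a frame.
-/
theorem horizontalLift_eq (σ : GL2Structure k E) (φ : GL2Connection k E) (u : Pairs E)
    {z : PairsModelSpace k} (hz : z ∈ (extChartAt (pairsModel k) u).target)
    (hzf : (extChartAt (pairsModel k) u).symm z ∈ frames E) {X : PairsModelSpace k} {v : V k}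
    (h1 : solderChart σ u z X = v) (h2 : connChart φ u z X = 0) :
    horizontalLift σ φ ((extChartAt (pairsModel k) u).symm z) v =
      mfderiv 𝓘(ℝ, PairsModelSpace k) (pairsModel k) (extChartAt (pairsModel k) u).symm z X := by
  subst h1
  set w := (extChartAt (pairsModel k) u).symm z with hw
  have hws : w ∈ (extChartAt (pairsModel k) u).source := (extChartAt _ u).map_target hz
  have hzw : extChartAt (pairsModel k) u w = z := (extChartAt _ u).right_inv hz
  have hinj : Function.Injective (fun X : TangentSpace (pairsModel k) w =>
      ((fun i => σ.solder i w X : V k), φ.mat w X)) := by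
    intro Y Y' h
    have hs : ∀ Y : TangentSpace (pairsModel k) w, ∃ Z : PairsModelSpace k,
        mfderiv 𝓘(ℝ, PairsModelSpace k) (pairsModel k) (extChartAt (pairsModel k) u).symm z Z = Y :=
      fun Y => ⟨_, by
        have := mfderiv_symm_mfderiv_extChartAt hws Y
        rwa [hzw] at this⟩
    obtain ⟨Z, rfl⟩ := hs Y
    obtain ⟨Z', rfl⟩ := hs Y'
    congr 1
    exact eq_of_solderChart_connChart σ φ u hz hzf (Prod.ext_iff.1 h).1 (Prod.ext_iff.1 h).2
  refine Eq.trans ?_ (Function.leftInverse_invFun hinj _)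
  exact congrArg (Function.invFun _) (Prod.ext rfl h2.symm)

end Lift

/-! ### From the intrinsic torsion and curvature to the chart, and the conclusion. -/

section Main

variable {k : ℕ}
  {M : Type*} [TopologicalSpace M] [ChartedSpace (EuclideanSpace ℝ (Fin (k + 1))) M]
  [IsManifold (𝓡 (k + 1)) ∞ M]
  {E : M → Type*} [∀ p, AddCommGroup (E p)] [∀ p, Module ℝ (E p)]
  [TopologicalSpace (TotalSpace (Fin 2 → ℝ) E)] [∀ p, TopologicalSpace (E p)]
  [FiberBundle (Fin 2 → ℝ) E] [VectorBundle ℝ (Fin 2 → ℝ) E]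
  [ContMDiffVectorBundle ∞ (Fin 2 → ℝ) E (𝓡 (k + 1))]

/-- The exterior derivative in a chart. -/
theorem OneForm.d_mfderiv_symm (η : OneForm (pairsModel k) (Pairs E)) (u : Pairs E)
    {z : PairsModelSpace k} (hz : z ∈ (extChartAt (pairsModel k) u).target)
    (hη : DifferentiableAt ℝ (η.inChart u) z) (X Y : PairsModelSpace k) :
    η.d ((extChartAt (pairsModel k) u).symm z)
      (mfderiv 𝓘(ℝ, PairsModelSpace k) (pairsModel k) (extChartAt (pairsModel k) u).symm z X)
      (mfderiv 𝓘(ℝ, PairsModelSpace k) (pairsModel k) (extChartAt (pairsModel k) u).symm z Y) =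
      fderiv ℝ (η.inChart u) z X Y - fderiv ℝ (η.inChart u) z Y X := by
  have hzw : extChartAt (pairsModel k) u ((extChartAt (pairsModel k) u).symm z) = z :=
    (extChartAt _ u).right_inv hz
  have key : ∀ z' X' Y' : PairsModelSpace k, z' = z → X' = X → Y' = Y →
      fderiv ℝ (η.inChart u) z' X' Y' - fderiv ℝ (η.inChart u) z' Y' X' =
        fderiv ℝ (η.inChart u) z X Y - fderiv ℝ (η.inChart u) z Y X := by
    rintro _ _ _ rfl rfl rfl; rfl
  exact (OneForm.d_eq η ((extChartAt (pairsModel k) u).map_target hz) (by rwa [hzw]) _ _).trans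
    (key _ _ _ hzw (mfderiv_extChartAt_mfderiv_symm hz X) (mfderiv_extChartAt_mfderiv_symm hz Y))

theorem torsion_mfderiv_symm (σ : GL2Structure k E) (φ : GL2Connection k E) (u : Pairs E)
    {z : PairsModelSpace k} (hz : z ∈ (extChartAt (pairsModel k) u).target)
    (hS : DifferentiableAt ℝ (solderChart σ u) z) (X Y : PairsModelSpace k) :
    torsion σ φ ((extChartAt (pairsModel k) u).symm z)
      (mfderiv 𝓘(ℝ, PairsModelSpace k) (pairsModel k) (extChartAt (pairsModel k) u).symm z X)
      (mfderiv 𝓘(ℝ, PairsModelSpace k) (pairsModel k) (extChartAt (pairsModel k) u).symm z Y) =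
      flatTorsion (repL k) (solderChart σ u) (connChart φ u) z X Y := by
  funext i
  have h1 : HasFDerivAt ((σ.solder i).inChart u)
      ((ContinuousLinearMap.compL ℝ (PairsModelSpace k) (V k) ℝ
        (ContinuousLinearMap.proj i)).comp (fderiv ℝ (solderChart σ u) z)) z :=
    (ContinuousLinearMap.compL ℝ (PairsModelSpace k) (V k) ℝ
        (ContinuousLinearMap.proj i)).hasFDerivAt.comp z hS.hasFDerivAt
  rw [torsion, OneForm.d_mfderiv_symm _ u hz h1.differentiableAt, h1.fderiv, Finset.sum_sub_distrib]
  rfl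

theorem curvature_mfderiv_symm (φ : GL2Connection k E) (u : Pairs E)
    {z : PairsModelSpace k} (hz : z ∈ (extChartAt (pairsModel k) u).target)
    (hC : DifferentiableAt ℝ (connChart φ u) z) {X Y : PairsModelSpace k}
    (hX : connChart φ u z X = 0) (hY : connChart φ u z Y = 0) :
    curvature φ ((extChartAt (pairsModel k) u).symm z)
      (mfderiv 𝓘(ℝ, PairsModelSpace k) (pairsModel k) (extChartAt (pairsModel k) u).symm z X)
      (mfderiv 𝓘(ℝ, PairsModelSpace k) (pairsModel k) (extChartAt (pairsModel k) u).symm z Y) =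
      Matrix.of (fderiv ℝ (connChart φ u) z X Y - fderiv ℝ (connChart φ u) z Y X) := by
  have h0 : ∀ Z : PairsModelSpace k, connChart φ u z Z = 0 →
      φ.mat ((extChartAt (pairsModel k) u).symm z) (mfderiv 𝓘(ℝ, PairsModelSpace k) (pairsModel k)
        (extChartAt (pairsModel k) u).symm z Z) = 0 := fun Z hZ => hZ
  rw [curvature, h0 X hX, h0 Y hY, mul_zero, sub_zero, add_zero]
  ext i j
  have h1 : HasFDerivAt ((φ.form i j).inChart u)
      ((ContinuousLinearMap.compL ℝ (PairsModelSpace k) (Fin 2 → Fin 2 → ℝ) ℝ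
        ((ContinuousLinearMap.proj (R := ℝ) (φ := fun _ : Fin 2 => ℝ) j).comp
          (ContinuousLinearMap.proj (R := ℝ) (φ := fun _ : Fin 2 => Fin 2 → ℝ) i))).comp
          (fderiv ℝ (connChart φ u) z)) z :=
    (ContinuousLinearMap.compL ℝ (PairsModelSpace k) (Fin 2 → Fin 2 → ℝ) ℝ
        ((ContinuousLinearMap.proj (R := ℝ) (φ := fun _ : Fin 2 => ℝ) j).comp
          (ContinuousLinearMap.proj (R := ℝ) (φ := fun _ : Fin 2 => Fin 2 → ℝ) i))).hasFDerivAt.comp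
      z hC.hasFDerivAt
  rw [Matrix.of_apply, OneForm.d_mfderiv_symm _ u hz h1.differentiableAt, h1.fderiv]
  rfl

/-- The torsion only depends on the values of the soldering form. -/
theorem flatTorsion_eq_of_solderChart (σ : GL2Structure k E) (φ : GL2Connection k E) (u : Pairs E)
    {z : PairsModelSpace k} (hz : z ∈ (extChartAt (pairsModel k) u).target)
    (hzf : (extChartAt (pairsModel k) u).symm z ∈ frames E)
    (hF : DifferentiableAt ℝ (frameChart σ u) z) (hS : DifferentiableAt ℝ (solderChart σ u) z)
    {X X' Y Y' : PairsModelSpace k} (hX : solderChart σ u z X = solderChart σ u z X')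
    (hY : solderChart σ u z Y = solderChart σ u z Y') :
    flatTorsion (repL k) (solderChart σ u) (connChart φ u) z X Y =
      flatTorsion (repL k) (solderChart σ u) (connChart φ u) z X' Y' := by
  have key : ∀ {X X' : PairsModelSpace k} (Y : PairsModelSpace k),
      solderChart σ u z X = solderChart σ u z X' →
      flatTorsion (repL k) (solderChart σ u) (connChart φ u) z X Y =
        flatTorsion (repL k) (solderChart σ u) (connChart φ u) z X' Y := by
    intro X X' Y h
    obtain ⟨A, hA⟩ := exists_vertical_eq u hz hzf
      ((solderChart_eq_zero σ u hz hzf (X := X - X')).1 (by rw [map_sub, h, sub_self]))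
    have h1 := flatTorsion_vertical σ φ u hz hzf hF hS A Y
    rw [← hA] at h1
    rw [← sub_eq_zero, ← h1]
    simp only [flatTorsion, map_sub, sub_apply]
    abel
  rw [key Y hX, flatTorsion_swap, key X' hY, ← flatTorsion_swap]

/-- If `T^{(1,1)}` and `T^{(0,2)}` vanish, the torsion commutes with the complex structure. -/
theorem flatTorsion_mulI (hk : Odd k) (σ : GL2Structure k E) (φ : GL2Connection k E)
    (hT11 : ∀ u ∈ frames E, ∀ j a b, torsion11 σ φ u j a b = 0)
    (hT02 : ∀ u ∈ frames E, ∀ j a b, torsion02 σ φ u j a b = 0) (u : Pairs E)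
    {z : PairsModelSpace k} (hz : z ∈ (extChartAt (pairsModel k) u).target)
    (hzf : (extChartAt (pairsModel k) u).symm z ∈ frames E)
    (hF : DifferentiableAt ℝ (frameChart σ u) z) (hS : DifferentiableAt ℝ (solderChart σ u) z)
    {X Y Y' : PairsModelSpace k} (hY : solderChart σ u z Y' = mulI k (solderChart σ u z Y)) :
    flatTorsion (repL k) (solderChart σ u) (connChart φ u) z X Y' =
      mulI k (flatTorsion (repL k) (solderChart σ u) (connChart φ u) z X Y) := by
  obtain ⟨ι, hι, hφι⟩ := exists_horizontal σ φ u hz hzf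
  have hι' : ∀ v, solderChart σ u z (ι v) = v := fun v => DFunLike.congr_fun hι v
  have hφι' : ∀ v, connChart φ u z (ι v) = 0 := fun v => DFunLike.congr_fun hφι v
  let B : V k →ₗ[ℝ] V k →ₗ[ℝ] V k := LinearMap.mk₂ ℝ
    (fun v w => flatTorsion (repL k) (solderChart σ u) (connChart φ u) z (ι v) (ι w))
    (fun v v' w => by
      simp only [flatTorsion, map_add, add_apply]; abel)
    (fun c v w => by
      simp only [flatTorsion, map_smul, smul_apply, smul_sub, smul_add])
    (fun v w w' => by
      simp only [flatTorsion, map_add, add_apply]; abel)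
    (fun c v w => by
      simp only [flatTorsion, map_smul, smul_apply, smul_sub, smul_add])
  have hB : ∀ v w, torsion σ φ ((extChartAt (pairsModel k) u).symm z)
      (horizontalLift σ φ ((extChartAt (pairsModel k) u).symm z) v)
      (horizontalLift σ φ ((extChartAt (pairsModel k) u).symm z) w) = B v w := fun v w => by
    rw [horizontalLift_eq σ φ u hz hzf (hι' v) (hφι' v),
      horizontalLift_eq σ φ u hz hzf (hι' w) (hφι' w), torsion_mfderiv_symm σ φ u hz hS]
    rfl
  have hBJ := mulI_of_comp hk B
    (fun j a b => by
      have := hT11 _ hzf j a b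
      simpa only [torsion11, hB] using this)
    (fun j a b => by
      have := hT02 _ hzf j a b
      simpa only [torsion02, hB] using this)
  -- Horizontality allows arbitrary vectors to be replaced by horizontal ones with the same
  -- soldering values, so the hypotheses on horizontal lifts control the torsion everywhere.
  have hflat : ∀ X Y, flatTorsion (repL k) (solderChart σ u) (connChart φ u) z X Y =
      B (solderChart σ u z X) (solderChart σ u z Y) := fun X Y =>
    flatTorsion_eq_of_solderChart σ φ u hz hzf hF hS (hι' _).symm (hι' _).symm
  rw [hflat, hflat, hY, hBJ]

theorem curvature02_eq_zero (hk : Odd k) (σ : GL2Structure k E) (φ : GL2Connection k E)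
    (hT11 : ∀ u ∈ frames E, ∀ j a b, torsion11 σ φ u j a b = 0)
    (hT02 : ∀ u ∈ frames E, ∀ j a b, torsion02 σ φ u j a b = 0) {u : Pairs E}
    (hu : u ∈ frames E) (a b : Fin (k / 2 + 1)) : curvature02 σ φ u a b = 0 := by
  set z := extChartAt (pairsModel k) u u with hzdef
  have hz : z ∈ (extChartAt (pairsModel k) u).target := mem_extChartAt_target u
  have hzu : (extChartAt (pairsModel k) u).symm z = u := extChartAt_to_inv u
  have hzf : (extChartAt (pairsModel k) u).symm z ∈ frames E := by rwa [hzu]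
  have hF := contDiffAt_frameChart σ u
  have hS := contDiffAt_solderChart σ hu
  have hC := (contDiffAt_connChart φ hu).differentiableAt (by simp)
  obtain ⟨ι, hι, hφι⟩ := exists_horizontal σ φ u hz hzf
  have hι' : ∀ v, solderChart σ u z (ι v) = v := fun v => DFunLike.congr_fun hι v
  have hφι' : ∀ v, connChart φ u z (ι v) = 0 := fun v => DFunLike.congr_fun hφι v
  have hO : ∀ v w, curvature φ ((extChartAt (pairsModel k) u).symm z)
      (horizontalLift σ φ ((extChartAt (pairsModel k) u).symm z) v)
      (horizontalLift σ φ ((extChartAt (pairsModel k) u).symm z) w) =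
      Matrix.of (fderiv ℝ (connChart φ u) z (ι v) (ι w) -
        fderiv ℝ (connChart φ u) z (ι w) (ι v)) := fun v w => by
    rw [horizontalLift_eq σ φ u hz hzf (hι' v) (hφι' v),
      horizontalLift_eq σ φ u hz hzf (hι' w) (hφι' w),
      curvature_mfderiv_symm φ u hz hC (hφι' v) (hφι' w)]
  rw [← hzu]
  simp only [curvature02, hO]
  rcases lt_or_ge 1 k with hk1 | hk1
  -- The torsion is going to be differentiated, so its type is needed at all frames near `u`.
  · have hev : ∀ᶠ y in 𝓝 z, ∀ X Y Y', solderChart σ u y Y' = mulI k (solderChart σ u y Y) →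
        flatTorsion (repL k) (solderChart σ u) (connChart φ u) y X Y' =
          mulI k (flatTorsion (repL k) (solderChart σ u) (connChart φ u) y X Y) := by
      filter_upwards [eventually_mem_frames u hz hzf,
        (hF.of_le (m := 1) (by simp)).eventually (by simp),
        (hS.of_le (m := 1) (by simp)).eventually (by simp)] with y hy hFy hSy X Y Y' h
      exact flatTorsion_mulI hk σ φ hT11 hT02 u hy.1 hy.2 (hFy.differentiableAt (by simp))
        (hSy.differentiableAt (by simp)) h
    obtain ⟨T, hTJ, hTs, hT⟩ := exists_bianchi_tensor (repL k)
      (hS.of_le (m := 2) ENat.LEInfty.out) hC (mulI k) hι hφι hev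
    exact comp02_zeta_eq_zero hk hk1 _ T hTJ hTs hT a b
  -- For `k = 1` the component `ξ^{m-1}` does not exist; with one index, skew-symmetry alone
  -- suffices.
  · have hsub : Subsingleton (Fin (k / 2 + 1)) := by
      rw [Fin.subsingleton_iff_le_one]; omega
    rw [Subsingleton.elim b a]
    refine comp02_self_eq_zero k _ (fun v w => ?_) a
    simp only [zeta, Matrix.of_apply, Pi.sub_apply]
    push_cast
    ring

end Main

end GL2

end
theorem mainTheorem7 (k : ℕ) (hk : Odd k)
    {M : Type*} [TopologicalSpace M] [ChartedSpace (EuclideanSpace ℝ (Fin (k + 1))) M]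
    [IsManifold (𝓡 (k + 1)) ∞ M]
    (E : M → Type*) [∀ p, AddCommGroup (E p)] [∀ p, Module ℝ (E p)]
    [TopologicalSpace (TotalSpace (Fin 2 → ℝ) E)] [∀ p, TopologicalSpace (E p)]
    [FiberBundle (Fin 2 → ℝ) E] [VectorBundle ℝ (Fin 2 → ℝ) E]
    [ContMDiffVectorBundle ∞ (Fin 2 → ℝ) E (𝓡 (k + 1))]
    (σ : GL2.GL2Structure k E) (φ : GL2.GL2Connection k E)
    (hT11 : ∀ u ∈ GL2.frames E, ∀ j a b, GL2.torsion11 σ φ u j a b = 0)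
    (hT02 : ∀ u ∈ GL2.frames E, ∀ j a b, GL2.torsion02 σ φ u j a b = 0) :
    ∀ u ∈ GL2.frames E, ∀ a b, GL2.curvature02 σ φ u a b = 0 :=
  fun _ hu a b => GL2.curvature02_eq_zero hk σ φ hT11 hT02 hu a b
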